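/- **Definitions.** A *compatibility scenario* $\Upsilon=(\mathcal M,\mathcal C,\mathcal O^{\mathcal M})$ consists of a finite set $\mathcal M$ of measurements, a family $\mathcal C$ of subsets of $\mathcal M$ (maximal contexts), none contained in another, and a finite nonempty outcome set $\mathcal O^x$ for each $x\in\mathcal M$. A *behavior* is a family $B=\{p_\gamma\}_{\gamma\in\mathcal C}$ of probability distributions $p_\gamma$ on $\mathcal O^\gamma=\prod_{x\in\gamma}\mathcal O^x$. $\mathrm{ND}(\Upsilon)$ is the set of nondisturbing behaviors (for all $\gamma,\gamma'\in\mathcal C$ the marginals of $p_\gamma$ and $p_{\gamma'}$ on $\gamma\cap\gamma'$ agree), and $\mathrm{NC}(\Upsilon)$ is the set of noncontextual ones (all $p_\gamma$ are marginals of one probability distribution on $\mathcal O^{\mathcal M}$). A *wiring* from $\Upsilon=(\mathcal M,\mathcal C,\mathcal O)$ to $\Upsilon'=(\mathcal M',\mathcal C',\mathcal O')$ is given by: a noncontextual behavior $\{p_\beta(\mathbf r)\}$ in a pre-processing scenario with the measurements $\mathcal M'$ and contexts $\mathcal C'$ of $\Upsilon'$ and arbitrary outcome sets; for each context $\beta\in\mathcal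 C'$ a function $f$ from the joint outcomes $\mathbf r$ for $\beta$ to $\mathcal C$; for each $(\mathbf r,\beta)$ a noncontextual behavior $\{p_\delta(\mathbf t)\}$ in some scenario $\Upsilon_{POS}^{(\mathbf r,\beta)}$; and functions $g_i(\cdot\,|\,\mathbf r,\beta)$, one for each measurement $i\in\gamma=f(\mathbf r)$, from the outcomes of $i$ to the measurements of $\Upsilon_{POS}^{(\mathbf r,\beta)}$, such that $g(\mathbf s|\mathbf r,\beta)=\bigcup_i\{g_i(s_i|\mathbf r,\beta)\}$ is a maximal context of $\Upsilon_{POS}^{(\mathbf r,\beta)}$ for every $\mathbf s\in\mathcal O^\gamma$. For each $x\in\beta$ one chooses, depending on $(\mathbf r,\beta)$, a measurement $i(x)\in\gamma$; the outcome reported for $x$ is the outcome of the post-processing measurement $g_{i(x)}(s_{i(x)}|\mathbf r,\beta)$, renamed as an element of $\mathcal O'^x$. With this identification the wiring maps $\{p_\gamma(\mathbf s)\}$ to $$p_\beta(\mathbf t)=\sum_{\mathbf r,\mathbf s}p_\beta(\mathbf r)\,p_{\gamma=f(\mathbf r)}(\mathbf s)\,p_{\delta=g(\mathbf s|\mathbf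 r,\beta)}(\mathbf t).$$ A *noncontextual wiring* (an element of $\mathrm{NCW}(\Upsilon\to\Upsilon')$) is such a wiring that is free, i.e. maps $\mathrm{ND}(\Upsilon)$ into $\mathrm{ND}(\Upsilon')$ and $\mathrm{NC}(\Upsilon)$ into $\mathrm{NC}(\Upsilon')$. Write $B\to B'$ if some noncontextual wiring maps $B$ to $B'$. Two behaviors are *incomparable* if neither $B\to B'$ nor $B'\to B$. For $n\ge3$ the *$n$-cycle scenario* $\Upsilon_n$ has measurements $x_0,\dots,x_{n-1}$ with outcomes $0,1$ and contexts $\{x_i,x_{i+1}\}$ (indices modulo $n$). Put $\langle x_ix_{i+1}\rangle=p(00|x_ix_{i+1})+p(11|x_ix_{i+1})-p(01|x_ix_{i+1})-p(10|x_ix_{i+1})$ and, for signs $a_i\in\{1,-1\}$ of which an odd number are $-1$ (the label $k$ stands for this choice), $I_k(B)=\sum_i a_i\langle x_ix_{i+1}\rangle$. Let $B_\varnothing$ be the behavior in which all joint outcomes of every context are equally likely, and let $\mathrm{NDC}(\Upsilon_n)$ be the set of the extreme points of $\mathrm{ND}(\Upsilon_n)$ that are not extreme points of $\mathrm{NC}(\Upsilon_n)$.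 If $B_k\in\mathrm{NDC}(\Upsilon_n)$ has $I_k(B_k)=n$, put $$B_\varepsilon=\varepsilon B_k+(1-\varepsilon)\Big(\tfrac{n-2}{n}B_k+\tfrac2nB_\varnothing\Big),\qquad B(\alpha,\varepsilon)=\alpha\tilde B+(1-\alpha)B_\varepsilon ,$$ where $\tilde B$ is an extreme point of $\mathrm{NC}(\Upsilon_n)$ with $I_k(\tilde B)=n-2$. The *cost* and *yield* are $$\mathsf c_k(B)=\min\{I_k(B_\varepsilon):\varepsilon\in[0,1],\ B_\varepsilon\to B\},\qquad \mathsf y_k(B)=\max\{I_k(B'):B'\in\mathrm{ND}(\Upsilon_n),\ B\to B'\}.$$ **Theorem.** The relation $\to$ on the class of all nondisturbing behaviors in all compatibility scenarios is not total: there are nondisturbing behaviors $B_1,B_2$ with $B_1\not\to B_2$ and $B_2\not\to B_1$. More precisely, let $n\ge3$ and let $k$ be any choice of signs as above. There is exactly one $B_k\in\mathrm{NDC}(\Upsilon_n)$ with $I_k(B_k)=n$, there is an extreme point $\tilde B$ of $\mathrm{NC}(\Upsilon_n)$ with $I_k(\tilde B)=n-2$, and for every such $\tilde B$ the behaviors $B_1=B(\tfrac14,\tfrac14)$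 and $B_2=B(\tfrac34,\tfrac12)$ are nondisturbing and incomparable, the cost and yield of both are attained, and $$\mathsf c_k(B_1)=n-\tfrac32<n-1=\mathsf c_k(B_2),\qquad \mathsf y_k(B_1)=n-\tfrac{13}8>n-\tfrac74=\mathsf y_k(B_2).$$ -/

import Mathlib

open scoped BigOperators

noncomputable section

namespace NCW

/-- A compatibility scenario: finitely many measurements, each with a finite nonempty set of
outcomes, and a family of maximal contexts, none of which contains another. -/
structure Scenario where
  M : Type
  C : Finset (Finset M)
  O : M → Type
  [fintypeM : Fintype M]
  [decEqM : DecidableEq M]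
  [fintypeO : ∀ x, Fintype (O x)]
  [nonemptyO : ∀ x, Nonempty (O x)]
  maximal : ∀ γ ∈ C, ∀ γ' ∈ C, γ ⊆ γ' → γ = γ'

attribute [instance] Scenario.fintypeM Scenario.decEqM Scenario.fintypeO Scenario.nonemptyO

namespace Scenario

variable (U : Scenario)

/-- The type of maximal contexts. -/
abbrev Ctx : Type := {γ : Finset U.M // γ ∈ U.C}

/-- Joint outcomes of a set `γ` of measurements. -/
abbrev Out (γ : Finset U.M) : Type := (x : {x // x ∈ γ}) → U.O x.1

/-- Global assignments of outcomes to all measurements. -/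
abbrev Global : Type := (x : U.M) → U.O x

/-- Tables of real numbers `p_γ(s)`; behaviors are the tables satisfying `IsBehavior`. -/
abbrev Table : Type := (γ : U.Ctx) → U.Out γ.1 → ℝ

variable {U}

/-- Restriction of a joint outcome to a smaller set of measurements. -/
def restrict {γ η : Finset U.M} (h : η ⊆ γ) (s : U.Out γ) : U.Out η :=
  fun x => s ⟨x.1, h x.2⟩

/-- Each `p_γ` is a probability distribution. -/
def IsBehavior (p : U.Table) : Prop :=
  ∀ γ : U.Ctx, (∀ s, 0 ≤ p γ s) ∧ ∑ s, p γ s = 1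

open Classical in
/-- Marginal of `p_γ` on `η ⊆ γ`. -/
def marginal (p : U.Table) (γ : U.Ctx) {η : Finset U.M} (h : η ⊆ γ.1) (u : U.Out η) : ℝ :=
  ∑ s : U.Out γ.1, if restrict h s = u then p γ s else 0

variable (U)

/-- The no-disturbance set: behaviors whose marginals agree on all intersections of contexts. -/
def ND : Set U.Table :=
  {p | IsBehavior p ∧ ∀ (γ γ' : U.Ctx) (u : U.Out (γ.1 ∩ γ'.1)),
    marginal p γ Finset.inter_subset_left u = marginal p γ' Finset.inter_subset_right u}

open Classical in
/-- The noncontextual set: the tables that are the marginals of a global section, i.e. of a single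
probability distribution on the global assignments. -/
def NC : Set U.Table :=
  {p | ∃ q : U.Global → ℝ, (∀ l, 0 ≤ q l) ∧ ∑ l, q l = 1 ∧
    ∀ (γ : U.Ctx) (s : U.Out γ.1),
      p γ s = ∑ l : U.Global, if (fun x : {x // x ∈ γ.1} => l x.1) = s then q l else 0}

/-- The scenario with the same measurements and contexts, and other outcome sets. -/
abbrev withOutcomes (O' : U.M → Type) [∀ x, Fintype (O' x)] [∀ x, Nonempty (O' x)] : Scenario where
  M := U.M
  C := U.C
  O := O'
  maximal := U.maximal

end Scenario

open Scenario

/-- The data of a wiring with noncontextual boxes, from the scenario `U` to the scenario `V`.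

On input `β` (a context of `V`), the noncontextual pre-processing box `pre` gives a joint outcome
`r`; the box to be transformed is measured in the context `f β r`, with joint outcome `s`; each
component `s_y` separately selects the measurement `g β r y s_y` of the post-processing scenario
`post β r`, these measurements together forming a context; the noncontextual post-processing box
`postBox β r` is measured in that context. The functions `slot` and `read` make the result a joint
outcome for the context `β`: the outcome of `x ∈ β` is the one of the post-processing measurement
selected by the component `slot β r x` of `s`, its values being named as outcomes of `x`. -/
structure Wiring (U V : Scenario) where
  OPre : V.M → Type
  [fintypeOPre : ∀ x, Fintype (OPre x)]
  [nonemptyOPre : ∀ x, Nonempty (OPre x)]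
  pre : (V.withOutcomes OPre).Table
  pre_mem : pre ∈ (V.withOutcomes OPre).NC
  f : (β : V.Ctx) → (V.withOutcomes OPre).Out β.1 → U.Ctx
  post : (β : V.Ctx) → (V.withOutcomes OPre).Out β.1 → Scenario
  postBox : (β : V.Ctx) → (r : (V.withOutcomes OPre).Out β.1) → (post β r).Table
  postBox_mem : ∀ β r, postBox β r ∈ (post β r).NC
  g : (β : V.Ctx) → (r : (V.withOutcomes OPre).Out β.1) →
    (y : {y // y ∈ (f β r).1}) → U.O y.1 → (post β r).M
  g_mem : ∀ β r (s : U.Out (f β r).1),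
    Finset.univ.image (fun y => g β r y (s y)) ∈ (post β r).C
  slot : (β : V.Ctx) → (r : (V.withOutcomes OPre).Out β.1) →
    {x // x ∈ β.1} → {y // y ∈ (f β r).1}
  read : (β : V.Ctx) → (r : (V.withOutcomes OPre).Out β.1) →
    (x : {x // x ∈ β.1}) → (u : (post β r).M) → (post β r).O u → V.O x.1

attribute [instance] Wiring.fintypeOPre Wiring.nonemptyOPre

namespace Wiring

variable {U V : Scenario} (w : Wiring U V)

/-- The post-processing context `δ = ⋃ᵢ gᵢ(sᵢ | r, β)`. -/
def ctxPost (β : V.Ctx) (r : (V.withOutcomes w.OPre).Out β.1) (s : U.Out (w.f β r).1) :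
    (w.post β r).Ctx :=
  ⟨Finset.univ.image (fun y => w.g β r y (s y)), w.g_mem β r s⟩

/-- The joint outcome for `β` that is read off from the post-processing outcome `t`. -/
def result (β : V.Ctx) (r : (V.withOutcomes w.OPre).Out β.1) (s : U.Out (w.f β r).1)
    (t : (w.post β r).Out (w.ctxPost β r s).1) : V.Out β.1 :=
  fun x => w.read β r x _
    (t ⟨w.g β r (w.slot β r x) (s (w.slot β r x)),
      Finset.mem_image_of_mem (fun y => w.g β r y (s y)) (Finset.mem_univ _)⟩)

open Classical in
/-- The action `p_β(t) = ∑_{r,s} p_β(r) p_{f(r)}(s) p_{g(s|r,β)}(t)` of the wiring. -/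
def apply (p : U.Table) : V.Table := fun β t =>
  ∑ r : (V.withOutcomes w.OPre).Out β.1, ∑ s : U.Out (w.f β r).1,
    w.pre β r * p (w.f β r) s *
      ∑ t' : (w.post β r).Out (w.ctxPost β r s).1,
        if w.result β r s t' = t then w.postBox β r (w.ctxPost β r s) t' else 0

/-- The wiring is a free operation: it maps objects (nondisturbing behaviors) to objects and free
objects (noncontextual behaviors) to free objects. -/
def IsFree : Prop :=
  (∀ p ∈ U.ND, w.apply p ∈ V.ND) ∧ (∀ p ∈ U.NC, w.apply p ∈ V.NC)

end Wiring

/-- `p → q`: some noncontextual wiring (free wiring with noncontextual boxes) takes `p` to `q`. -/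
def Converts {U V : Scenario} (p : U.Table) (q : V.Table) : Prop :=
  ∃ w : Wiring U V, w.IsFree ∧ w.apply p = q

/-- Neither behavior can be converted into the other. -/
def Incomparable {U V : Scenario} (p : U.Table) (q : V.Table) : Prop :=
  ¬ Converts p q ∧ ¬ Converts q p

/-- The objects: nondisturbing behaviors in arbitrary compatibility scenarios. -/
abbrev Object : Type 1 := (U : Scenario) × {p : U.Table // p ∈ U.ND}

section Cycle

variable (n : ℕ) [NeZero n]

/-- The `n`-cycle scenario: dichotomic measurements `x_i`, contexts `{x_i, x_{i+1}}`, with `i`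
modulo `n`. -/
def cycle : Scenario where
  M := Fin n
  C := Finset.univ.image (fun i : Fin n => {i, i + 1})
  O := fun _ => Fin 2
  maximal := by
    intro γ hγ γ' hγ' hsub
    obtain ⟨i, -, rfl⟩ := Finset.mem_image.1 hγ
    obtain ⟨j, -, rfl⟩ := Finset.mem_image.1 hγ'
    by_cases h : n = 1
    · subst h
      have : i = j := Subsingleton.elim _ _
      rw [this]
    · have hne : i ≠ i + 1 := by
        intro hi
        have h1 : (1 : Fin n) = 0 := by simpa using hi.symm
        have h2 := congrArg Fin.val h1
        have h3 : 0 < n := Nat.pos_of_ne_zero (NeZero.ne n)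
        have h4 : 1 < n := by omega
        rw [Fin.val_one', Fin.val_zero, Nat.mod_eq_of_lt h4] at h2
        omega
      refine Finset.eq_of_subset_of_card_le hsub ?_
      rw [Finset.card_pair hne]
      exact Finset.card_le_two

variable {n}

/-- The measurement `x_i`. -/
abbrev meas (i : Fin n) : (cycle n).M := i

/-- The context `{x_i, x_{i+1}}`. -/
def edge (i : Fin n) : (cycle n).Ctx :=
  ⟨{meas i, meas (i + 1)}, Finset.mem_image_of_mem (fun i : Fin n => ({i, i + 1} : Finset (Fin n)))
    (Finset.mem_univ i)⟩

open Classical in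
/-- The sign with which the joint outcome `s` of `{x_i, x_{i+1}}` enters the correlation: `1` for
equal outcomes, `-1` for different ones. -/
def paritySign (i : Fin n) (s : (cycle n).Out (edge i).1) : ℝ :=
  if (s ⟨meas i, Finset.mem_insert_self _ _⟩ : Fin 2) =
    s ⟨meas (i + 1), Finset.mem_insert_of_mem (Finset.mem_singleton_self _)⟩ then 1 else -1

/-- The correlation `⟨x_i x_{i+1}⟩`. -/
def corr (p : (cycle n).Table) (i : Fin n) : ℝ :=
  ∑ s : (cycle n).Out (edge i).1, paritySign i s * p (edge i) s

/-- The functional `I(B) = ∑ a_i ⟨x_i x_{i+1}⟩`. -/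
def ineqFun (a : Fin n → ℤˣ) (p : (cycle n).Table) : ℝ :=
  ∑ i, ((a i : ℤ) : ℝ) * corr p i

/-- The number of coefficients equal to `-1` is odd; such sign vectors label the facet inequalities
`I(B) ≤ n - 2`. -/
def OddSigns (a : Fin n → ℤˣ) : Prop :=
  Odd (Finset.univ.filter (fun i => a i = -1)).card

variable (n)

/-- The contextual vertices of the no-disturbance polytope. -/
def NDC : Set (cycle n).Table :=
  (cycle n).ND.extremePoints ℝ \ (cycle n).NC.extremePoints ℝ

/-- The behavior in which all joint outcomes of a context are equally likely. -/
def uniformBox : (cycle n).Table :=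
  fun γ _ => 1 / (Fintype.card ((cycle n).Out γ.1) : ℝ)

variable {n}

/-- `B_ε = ε B_k + (1 - ε) B_k'` with `B_k' = ((n - 2)/n) B_k + (2/n) B_∅`, for `B_k = v`. -/
def noisy (v : (cycle n).Table) (ε : ℝ) : (cycle n).Table :=
  ε • v + (1 - ε) • ((((n : ℝ) - 2) / n) • v + (2 / (n : ℝ)) • uniformBox n)

/-- `B(α, ε) = α B̃ + (1 - α) B_ε`. -/
def family (v b : (cycle n).Table) (α ε : ℝ) : (cycle n).Table :=
  α • b + (1 - α) • noisy v ε

/-- The values whose maximum is the yield `y_k(B)`. -/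
def yieldValues (a : Fin n → ℤˣ) (p : (cycle n).Table) : Set ℝ :=
  {c | ∃ q ∈ (cycle n).ND, Converts p q ∧ ineqFun a q = c}

/-- The values whose minimum is the cost `c_k(B)`; `v` is the vertex `B_k`. -/
def costValues (a : Fin n → ℤˣ) (v p : (cycle n).Table) : Set ℝ :=
  {c | ∃ ε ∈ Set.Icc (0 : ℝ) 1, Converts (noisy v ε) p ∧ ineqFun a (noisy v ε) = c}

end Cycle

end NCW

end

/-!
The bounds on cost and yield rest on two facts about a free wiring `w` of the `n`-cycle scenario.

* `w` acts linearly on tables, and maps nondisturbing behaviors to nondisturbing and noncontextual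
  ones to noncontextual ones. On these sets `I ≤ n` and `I ≤ n - 2`.
* The statistics of a single measurement after `w` is determined by the statistics of single
  measurements before it (`Wiring.exists_mean_apply_eq`), because a noncontextual box does not
  disturb and every component of the outcome is processed separately.

Adding up facet inequalities of the no-disturbance polytope around the cycle gives
`I(p) ≤ n - 2 |⟨x_i⟩|` on it (`ineqFun_le_sub_abs_bias`). This yields the bounds on `I`, the
uniqueness of `B_k` (a maximizer of `I` has `⟨x_i⟩ = 0` and `⟨x_i x_{i+1}⟩ = a_i`, which determines
it) and `I(p) ≤ n - 2 + 4 P(x_i = c)` for both outcomes `c`. As the mixture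
`B_k' = ((n - 2)/n) B_k + (2/n) B_∅` is noncontextual, being the average of the `2n` deterministic
behaviors with `I = n - 2`, the behavior `B(α, ε)` is a mixture of `B_k`, with the weight
`(1 - α) ε`, and noncontextual behaviors.

*Yield.* Only the part `B_k` can contribute more than `n - 2` after `w`, and at most `n`. So `I` is
at most `n - 2 + 2 ε (1 - α)`, which is its value at `B(α, ε)` itself.

*Cost.* Let `q` be the image of `B(α', ε')` under `w`. All single measurements are unbiased in `B_k`
and in `B_k'`, hence their images assign the same probability to `x_i = c`. With the inequality above
for the image of `B_k` this gives `I(q) ≤ n - 2 + 4 ε' P_q(x_i = c)`. If `q = B(α, ε)`, and `c` is the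
outcome of `x_i` that does not occur in the deterministic behavior `B̃`, then
`I(q) = n - 2 + 2 ε (1 - α)` and `P_q(x_i = c) = (1 - α)/2`, so that `ε ≤ ε'`
(`le_of_converts_family`). In the other direction, mixing with `B̃` is a free wiring
(`converts_mix`), which takes `B_ε` to `B(α, ε)`.

The two behaviors are incomparable since one has the larger `I` and the other the larger `ε`.
-/

open scoped BigOperators

noncomputable section

namespace NCW

/-! ### Noncontextual and nondisturbing behaviors -/

namespace Scenario

variable {U : Scenario}

open Classical in
/-- The table of the marginals of a weight `q` on the global assignments. The weight may take
negative values. -/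
def ofGlobal (q : U.Global → ℝ) : U.Table := fun γ s =>
  ∑ l : U.Global, if (fun x : {x // x ∈ γ.1} => l x.1) = s then q l else 0

theorem mem_NC_iff {p : U.Table} :
    p ∈ U.NC ↔ ∃ q : U.Global → ℝ, (∀ l, 0 ≤ q l) ∧ ∑ l, q l = 1 ∧ p = ofGlobal q := by
  constructor
  · rintro ⟨q, h0, h1, h⟩
    exact ⟨q, h0, h1, funext fun γ => funext fun s => h γ s⟩
  · rintro ⟨q, h0, h1, rfl⟩
    exact ⟨q, h0, h1, fun _ _ => rfl⟩

theorem ofGlobal_add (q q' : U.Global → ℝ) :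
    ofGlobal (q + q') = ofGlobal q + ofGlobal q' := by
  funext γ s
  simp only [ofGlobal, Pi.add_apply, ← Finset.sum_add_distrib]
  refine Finset.sum_congr rfl fun l _ => ?_
  split_ifs <;> simp

theorem ofGlobal_smul (c : ℝ) (q : U.Global → ℝ) :
    ofGlobal (c • q) = c • ofGlobal q := by
  funext γ s
  simp only [ofGlobal, Pi.smul_apply, smul_eq_mul, Finset.mul_sum, mul_ite, mul_zero]

/-- Expectation values in a context of `ofGlobal q` are expectation values of `q`. -/
theorem sum_mul_ofGlobal (q : U.Global → ℝ) (γ : U.Ctx) (F : U.Out γ.1 → ℝ) :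
    ∑ s, F s * ofGlobal q γ s = ∑ l : U.Global, F (fun x => l x.1) * q l := by
  classical
  simp only [ofGlobal, Finset.mul_sum]
  rw [Finset.sum_comm]
  refine Finset.sum_congr rfl fun l _ => ?_
  rw [Finset.sum_eq_single (fun x : {x // x ∈ γ.1} => l x.1)]
  · simp
  · intro s _ hs
    rw [if_neg (fun h => hs h.symm), mul_zero]
  · simp

theorem isBehavior_ofGlobal {q : U.Global → ℝ} (h0 : ∀ l, 0 ≤ q l) (h1 : ∑ l, q l = 1) :
    IsBehavior (ofGlobal q) := by
  classical
  refine fun γ => ⟨fun s => Finset.sum_nonneg fun l _ => ?_, ?_⟩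
  · split_ifs
    exacts [h0 l, le_rfl]
  · simpa [h1] using sum_mul_ofGlobal q γ (fun _ => 1)

/-- A behavior that has a global section with possibly negative weights is nondisturbing. -/
theorem ofGlobal_mem_ND {q : U.Global → ℝ} (h : IsBehavior (ofGlobal q)) :
    ofGlobal q ∈ U.ND := by
  classical
  have key : ∀ (γ : U.Ctx) (η : Finset U.M) (hη : η ⊆ γ.1) (u : U.Out η),
      marginal (ofGlobal q) γ hη u =
        ∑ l : U.Global, if (fun x : {x // x ∈ η} => l x.1) = u then q l else 0 := by
    intro γ η hη u
    have := sum_mul_ofGlobal q γ (fun s => if restrict hη s = u then 1 else 0)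
    simp only [ite_mul, one_mul, zero_mul] at this
    unfold marginal
    rw [this]
    rfl
  exact ⟨h, fun γ γ' u => by rw [key, key]⟩

theorem NC_subset_ND : U.NC ⊆ U.ND := by
  intro p hp
  obtain ⟨q, h0, h1, rfl⟩ := mem_NC_iff.1 hp
  exact ofGlobal_mem_ND (isBehavior_ofGlobal h0 h1)

theorem convex_NC : Convex ℝ U.NC := by
  intro p hp p' hp' a b ha hb hab
  obtain ⟨q, h0, h1, rfl⟩ := mem_NC_iff.1 hp
  obtain ⟨q', h0', h1', rfl⟩ := mem_NC_iff.1 hp'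
  refine mem_NC_iff.2 ⟨a • q + b • q', fun l => ?_, ?_, ?_⟩
  · have := h0 l
    have := h0' l
    simp only [Pi.add_apply, Pi.smul_apply, smul_eq_mul]
    positivity
  · simp only [Pi.add_apply, Pi.smul_apply, smul_eq_mul, Finset.sum_add_distrib,
      ← Finset.mul_sum, h1, h1', mul_one, hab]
  · rw [ofGlobal_add, ofGlobal_smul, ofGlobal_smul]

theorem convex_ND : Convex ℝ U.ND := by
  classical
  intro p hp p' hp' a b ha hb hab
  have key : ∀ (γ : U.Ctx) (η : Finset U.M) (hη : η ⊆ γ.1) (u : U.Out η),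
      marginal (a • p + b • p') γ hη u = a * marginal p γ hη u + b * marginal p' γ hη u := by
    intro γ η hη u
    simp only [marginal, Finset.mul_sum, ← Finset.sum_add_distrib]
    refine Finset.sum_congr rfl fun s _ => ?_
    split_ifs <;> simp
  refine ⟨fun γ => ⟨fun s => ?_, ?_⟩, fun γ γ' u => ?_⟩
  · have := (hp.1 γ).1 s
    have := (hp'.1 γ).1 s
    simp only [Pi.add_apply, Pi.smul_apply, smul_eq_mul]
    positivity
  · simp only [Pi.add_apply, Pi.smul_apply, smul_eq_mul, Finset.sum_add_distrib,
      ← Finset.mul_sum, (hp.1 γ).2, (hp'.1 γ).2, mul_one, hab]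
  · rw [key, key, hp.2 γ γ' u, hp'.2 γ γ' u]

open Classical in
/-- The noncontextual behavior in which the outcome of `x` is `l x` with certainty. -/
def detBox (l : U.Global) : U.Table := ofGlobal (Pi.single l 1)

theorem detBox_mem_NC (l : U.Global) : detBox l ∈ U.NC := by
  classical
  refine mem_NC_iff.2 ⟨Pi.single l 1, fun l' => ?_, ?_, rfl⟩
  · by_cases h : l' = l
    · subst h
      simp
    · simp [h]
  · simp

theorem sum_mul_detBox (l : U.Global) (γ : U.Ctx) (F : U.Out γ.1 → ℝ) :
    ∑ s, F s * detBox l γ s = F (fun x => l x.1) := by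
  classical
  rw [detBox, sum_mul_ofGlobal, Finset.sum_eq_single l]
  · simp
  · intro l' _ h
    simp [h]
  · simp

open Classical in
theorem detBox_apply (l : U.Global) (γ : U.Ctx) (s : U.Out γ.1) :
    detBox l γ s = if (fun x : {x // x ∈ γ.1} => l x.1) = s then 1 else 0 := by
  have := sum_mul_detBox l γ (fun s' => if s' = s then 1 else 0)
  simpa using this

theorem ofGlobal_eq_sum (q : U.Global → ℝ) : ofGlobal q = ∑ l, q l • detBox l := by
  classical
  funext γ s
  simp only [Finset.sum_apply, Pi.smul_apply, smul_eq_mul, detBox_apply, mul_ite, mul_one,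
    mul_zero]
  rfl

theorem NC_eq_convexHull : U.NC = convexHull ℝ (Set.range (detBox (U := U))) := by
  refine Set.Subset.antisymm (fun p hp => ?_) (convexHull_min ?_ convex_NC)
  · obtain ⟨q, h0, h1, rfl⟩ := mem_NC_iff.1 hp
    rw [ofGlobal_eq_sum]
    exact (convex_convexHull ℝ _).sum_mem (fun l _ => h0 l) h1
      fun l _ => subset_convexHull ℝ _ ⟨l, rfl⟩
  · rintro _ ⟨l, rfl⟩
    exact detBox_mem_NC l

/-- The vertices of the noncontextual polytope are deterministic. -/
theorem exists_eq_detBox_of_mem_extremePoints {b : U.Table} (hb : b ∈ U.NC.extremePoints ℝ) :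
    ∃ l, b = detBox l := by
  rw [NC_eq_convexHull] at hb
  obtain ⟨l, hl⟩ := extremePoints_convexHull_subset hb
  exact ⟨l, hl.symm⟩

theorem IsBehavior.le_one {p : U.Table} (hp : IsBehavior p) (γ : U.Ctx) (s : U.Out γ.1) :
    p γ s ≤ 1 := by
  rw [← (hp γ).2]
  exact Finset.single_le_sum (fun s _ => (hp γ).1 s) (Finset.mem_univ s)

/-- The entries of a deterministic behavior are extreme values of the entries of a behavior. -/
theorem detBox_mem_extremePoints (l : U.Global) : detBox l ∈ U.NC.extremePoints ℝ := by
  classical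
  refine ⟨detBox_mem_NC l, fun p hp p' hp' h => ?_⟩
  obtain ⟨a, b, ha, hb, hab, h⟩ := h
  funext γ s
  have e := congrFun (congrFun h γ) s
  have hp := (NC_subset_ND hp).1
  have hp' := (NC_subset_ND hp').1
  have h0 := (hp γ).1 s
  have h0' := (hp' γ).1 s
  have h1 := hp.le_one γ s
  have h1' := hp'.le_one γ s
  rw [detBox_apply] at e ⊢
  simp only [Pi.add_apply, Pi.smul_apply, smul_eq_mul] at e
  split_ifs at e ⊢ <;> nlinarith

/-- The expectation value of a function of the outcome of the measurement `x`, in the context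
`γ`. -/
def mean (p : U.Table) (γ : U.Ctx) (x : {x // x ∈ γ.1}) (φ : U.O x.1 → ℝ) : ℝ :=
  ∑ s, φ (s x) * p γ s

theorem mean_add (p p' : U.Table) (γ : U.Ctx) (x : {x // x ∈ γ.1}) (φ : U.O x.1 → ℝ) :
    mean (p + p') γ x φ = mean p γ x φ + mean p' γ x φ := by
  simp [mean, mul_add, Finset.sum_add_distrib]

theorem mean_smul (c : ℝ) (p : U.Table) (γ : U.Ctx) (x : {x // x ∈ γ.1}) (φ : U.O x.1 → ℝ) :
    mean (c • p) γ x φ = c * mean p γ x φ := by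
  simp only [mean, Pi.smul_apply, smul_eq_mul, Finset.mul_sum]
  exact Finset.sum_congr rfl fun _ _ => by ring

theorem mean_nonneg {p : U.Table} (hp : IsBehavior p) (γ : U.Ctx) (x : {x // x ∈ γ.1})
    {φ : U.O x.1 → ℝ} (hφ : ∀ o, 0 ≤ φ o) : 0 ≤ mean p γ x φ :=
  Finset.sum_nonneg fun s _ => mul_nonneg (hφ _) ((hp γ).1 s)

/-- In a nondisturbing behavior, the statistics of one measurement does not depend on the
context. -/
theorem mean_eq_of_mem_ND {p : U.Table} (hp : p ∈ U.ND) (γ γ' : U.Ctx) (x : U.M) (hx : x ∈ γ.1)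
    (hx' : x ∈ γ'.1) (φ : U.O x → ℝ) : mean p γ ⟨x, hx⟩ φ = mean p γ' ⟨x, hx'⟩ φ := by
  classical
  have key : ∀ (δ : U.Ctx) (η : Finset U.M) (hη : η ⊆ δ.1) (h : x ∈ η),
      mean p δ ⟨x, hη h⟩ φ = ∑ u : U.Out η, φ (u ⟨x, h⟩) * marginal p δ hη u := by
    intro δ η hη h
    simp only [marginal, Finset.mul_sum, mean]
    rw [Finset.sum_comm]
    refine Finset.sum_congr rfl fun s _ => ?_
    rw [Finset.sum_eq_single (restrict hη s)]
    · simp [restrict]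
    · intro u _ hu
      rw [if_neg (fun h => hu h.symm), mul_zero]
    · simp
  have hmem : x ∈ γ.1 ∩ γ'.1 := Finset.mem_inter.2 ⟨hx, hx'⟩
  rw [key γ _ Finset.inter_subset_left hmem, key γ' _ Finset.inter_subset_right hmem]
  exact Finset.sum_congr rfl fun u _ => by rw [hp.2 γ γ' u]

end Scenario

open Scenario

/-! ### Wirings -/

namespace Wiring

variable {U V : Scenario} (w : Wiring U V)

theorem apply_add (p p' : U.Table) : w.apply (p + p') = w.apply p + w.apply p' := by
  funext β t
  simp only [apply, Pi.add_apply, ← Finset.sum_add_distrib]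
  exact Finset.sum_congr rfl fun r _ => Finset.sum_congr rfl fun s _ => by ring

theorem apply_smul (c : ℝ) (p : U.Table) : w.apply (c • p) = c • w.apply p := by
  funext β t
  simp only [apply, Pi.smul_apply, smul_eq_mul, Finset.mul_sum]
  exact Finset.sum_congr rfl fun r _ => Finset.sum_congr rfl fun s _ =>
    Finset.sum_congr rfl fun t' _ => by ring

/-- The statistics of a single measurement after a wiring is determined by the statistics of single
measurements before it: the outcome of `x` is read off from one post-processing measurement, which
is selected by one component of `s`, and whose statistics does not depend on the rest of the
post-processing context. -/
theorem exists_mean_apply_eq (β : V.Ctx) (x : {x // x ∈ β.1}) (φ : V.O x.1 → ℝ) :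
    ∃ κ : (r : (V.withOutcomes w.OPre).Out β.1) → U.O (w.slot β r x).1 → ℝ,
      ∀ p, mean (w.apply p) β x φ =
        ∑ r, w.pre β r * mean p (w.f β r) (w.slot β r x) (κ r) := by
  classical
  choose q _ _ hq using fun r => mem_NC_iff.1 (w.postBox_mem β r)
  refine ⟨fun r o => ∑ l : (w.post β r).Global,
    φ (w.read β r x _ (l (w.g β r (w.slot β r x) o))) * q r l, fun p => ?_⟩
  simp only [mean, apply, Finset.mul_sum]
  rw [Finset.sum_comm]
  refine Finset.sum_congr rfl fun r _ => ?_
  rw [Finset.sum_comm]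
  refine Finset.sum_congr rfl fun s _ => ?_
  rw [Finset.sum_comm]
  have hin := sum_mul_ofGlobal (q r) (w.ctxPost β r s) (fun t' => φ (w.result β r s t' x))
  rw [← hq r] at hin
  calc ∑ t', ∑ t, φ (t x) * (w.pre β r * p (w.f β r) s *
          if w.result β r s t' = t then w.postBox β r (w.ctxPost β r s) t' else 0)
      = ∑ t', w.pre β r * p (w.f β r) s *
          (φ (w.result β r s t' x) * w.postBox β r (w.ctxPost β r s) t') := by
        refine Finset.sum_congr rfl fun t' _ => ?_
        rw [Finset.sum_eq_single (w.result β r s t')]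
        · rw [if_pos rfl]
          ring
        · intro t _ ht
          rw [if_neg (fun h => ht h.symm)]
          ring
        · simp
    _ = _ := by
        rw [← Finset.mul_sum, hin, Finset.sum_mul, Finset.mul_sum, Finset.mul_sum]
        refine Finset.sum_congr rfl fun l _ => ?_
        simp only [result]
        ring

end Wiring

/-! ### Mixing with a noncontextual behavior -/

/-- The post-processing scenario in which the outcome `s_y` of every `y ∈ γ` selects a measurement
of its own, the label `⟨y, s_y⟩`, with only one outcome. -/
def recordScenario (U : Scenario) (γ : Finset U.M) : Scenario where
  M := (y : {y // y ∈ γ}) × U.O y.1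
  C :=
    letI : DecidableEq ((y : {y // y ∈ γ}) × U.O y.1) := Classical.decEq _
    Finset.univ.image fun s : U.Out γ => Finset.univ.image fun y => ⟨y, s y⟩
  O := fun _ => Unit
  fintypeM := inferInstance
  decEqM := Classical.decEq _
  maximal := by
    let : DecidableEq ((y : {y // y ∈ γ}) × U.O y.1) := Classical.decEq _
    intro δ hδ δ' hδ' h
    obtain ⟨s, -, rfl⟩ := Finset.mem_image.1 hδ
    obtain ⟨s', -, rfl⟩ := Finset.mem_image.1 hδ'
    have : s = s' := by
      funext y
      obtain ⟨y', -, hy'⟩ := Finset.mem_image.1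
        (h (Finset.mem_image_of_mem (fun y => (⟨y, s y⟩ : (y : {y // y ∈ γ}) × U.O y.1))
          (Finset.mem_univ y)))
      obtain ⟨rfl, h⟩ := Sigma.mk.inj_iff.1 hy'
      exact (eq_of_heq h).symm
    rw [this]

theorem const_one_mem_NC_recordScenario (U : Scenario) (γ : Finset U.M) :
    (fun _ _ => 1 : (recordScenario U γ).Table) ∈ (recordScenario U γ).NC := by
  classical
  have : ∀ x, Unique ((recordScenario U γ).O x) := fun _ => inferInstanceAs (Unique Unit)
  refine ⟨fun _ => 1, fun _ => zero_le_one, by simp, fun δ s => ?_⟩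
  rw [Fintype.sum_unique, if_pos (Subsingleton.elim _ _)]

/-- The weight on the assignments of `Option`-valued outcomes that gives the assignment `some ∘ l`
the weight `α * q l`, and the constant `none` the weight `1 - α`. -/
def mixWeight {U : Scenario} (α : ℝ) (q : U.Global → ℝ)
    (m : (U.withOutcomes fun x => Option (U.O x)).Global) : ℝ := by
  classical
  exact (∑ l, if (fun x => some (l x)) = m then α * q l else 0) +
    if (fun _ => none) = m then 1 - α else 0

theorem sum_mul_mixWeight {U : Scenario} (α : ℝ) (q : U.Global → ℝ)
    (F : (U.withOutcomes fun x => Option (U.O x)).Global → ℝ) :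
    ∑ m, F m * mixWeight α q m =
      α * ∑ l : U.Global, F (fun x => some (l x)) * q l + (1 - α) * F (fun _ => none) := by
  classical
  simp only [mixWeight, mul_add, Finset.sum_add_distrib, Finset.mul_sum]
  rw [Finset.sum_comm]
  simp only [mul_ite, mul_zero, Finset.sum_ite_eq, Finset.mem_univ, if_true]
  congr 1
  · exact Finset.sum_congr rfl fun l _ => by ring
  · ring

theorem ofGlobal_mixWeight_mem_NC {U : Scenario} {α : ℝ} (h0 : 0 ≤ α) (h1 : α ≤ 1)
    {q : U.Global → ℝ} (hq : ∀ l, 0 ≤ q l) (hs : ∑ l, q l = 1) :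
    ofGlobal (mixWeight α q) ∈ (U.withOutcomes fun x => Option (U.O x)).NC := by
  classical
  refine mem_NC_iff.2 ⟨_, fun m => ?_, ?_, rfl⟩
  · refine add_nonneg (Finset.sum_nonneg fun l _ => ?_) ?_
    · split_ifs
      exacts [mul_nonneg h0 (hq l), le_rfl]
    · split_ifs
      exacts [sub_nonneg.2 h1, le_rfl]
  · have := sum_mul_mixWeight α q (fun _ => 1)
    simpa [hs] using this

/-- The wiring that discards its input and outputs a noncontextual behavior with global section `q`
with probability `α`, and outputs its input otherwise. The pre-processing box shares the global
assignment to be output, or `none` if the input is to be kept. -/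
def mixWiring {U : Scenario} {α : ℝ} (h0 : 0 ≤ α) (h1 : α ≤ 1)
    {q : U.Global → ℝ} (hq : ∀ l, 0 ≤ q l) (hs : ∑ l, q l = 1) : Wiring U U where
  OPre := fun x => Option (U.O x)
  pre := ofGlobal (mixWeight α q)
  pre_mem := ofGlobal_mixWeight_mem_NC h0 h1 hq hs
  f := fun β _ => β
  post := fun β _ => recordScenario U β.1
  postBox := fun _ _ _ _ => 1
  postBox_mem := fun β _ => const_one_mem_NC_recordScenario U β.1
  g := fun _ _ y o => ⟨y, o⟩
  g_mem := fun β r s =>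
    letI : DecidableEq ((y : {y // y ∈ β.1}) × U.O y.1) := Classical.decEq _
    Finset.mem_image.2 ⟨s, Finset.mem_univ _, rfl⟩
  slot := fun _ _ x => x
  read := fun β r x u _ => by
    classical
    exact (r x).getD (if h : u.1 = x then h ▸ u.2 else Classical.arbitrary _)

theorem mixWiring_apply {U : Scenario} {α : ℝ} (h0 : 0 ≤ α) (h1 : α ≤ 1)
    {q : U.Global → ℝ} (hq : ∀ l, 0 ≤ q l) (hs : ∑ l, q l = 1) {p : U.Table}
    (hp : IsBehavior p) :
    (mixWiring h0 h1 hq hs).apply p = α • ofGlobal q + (1 - α) • p := by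
  classical
  funext β t
  have hres : ∀ (r : (U.withOutcomes fun x => Option (U.O x)).Out β.1) (s : U.Out β.1) t',
      (mixWiring h0 h1 hq hs).result β r s t' = fun x => (r x).getD (s x) := by
    intro r s t'
    funext x
    simp [Wiring.result, mixWiring]
  have hsum : ∀ (r : (U.withOutcomes fun x => Option (U.O x)).Out β.1) (s : U.Out β.1),
      (∑ t' : ((mixWiring h0 h1 hq hs).post β r).Out
          ((mixWiring h0 h1 hq hs).ctxPost β r s).1,
        if (mixWiring h0 h1 hq hs).result β r s t' = t then
          (mixWiring h0 h1 hq hs).postBox β r ((mixWiring h0 h1 hq hs).ctxPost β r s) t' else 0) =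
      if (fun x => (r x).getD (s x)) = t then 1 else 0 := by
    intro r s
    simp only [hres]
    split_ifs with h
    · exact ((NC_subset_ND ((mixWiring h0 h1 hq hs).postBox_mem β r)).1 _).2
    · exact Finset.sum_const_zero
  calc (mixWiring h0 h1 hq hs).apply p β t
      = ∑ r : (U.withOutcomes fun x => Option (U.O x)).Out β.1,
          (∑ s, if (fun x => (r x).getD (s x)) = t then p β s else 0) *
            ofGlobal (mixWeight α q) β r := by
        simp only [Wiring.apply]
        refine Finset.sum_congr rfl fun r _ => ?_
        rw [Finset.sum_mul]
        refine Finset.sum_congr rfl fun s _ => ?_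
        rw [hsum r s]
        split_ifs
        · simp only [mul_one]
          exact mul_comm _ _
        · simp
    _ = _ := by
        rw [sum_mul_ofGlobal, sum_mul_mixWeight]
        simp only [Option.getD_some, Option.getD_none, Pi.add_apply, Pi.smul_apply, smul_eq_mul]
        congr 2
        · refine Finset.sum_congr rfl fun l _ => ?_
          split_ifs
          · rw [(hp β).2, one_mul]
          · simp
        · simp

/-- Mixing with a noncontextual behavior is free. -/
theorem converts_mix {U : Scenario} {p b : U.Table} (hp : p ∈ U.ND) (hb : b ∈ U.NC) {α : ℝ}
    (h0 : 0 ≤ α) (h1 : α ≤ 1) : Converts p (α • b + (1 - α) • p) := by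
  obtain ⟨q, hq, hs, rfl⟩ := mem_NC_iff.1 hb
  refine ⟨mixWiring h0 h1 hq hs, ⟨fun p' hp' => ?_, fun p' hp' => ?_⟩,
    mixWiring_apply h0 h1 hq hs hp.1⟩
  · rw [mixWiring_apply h0 h1 hq hs hp'.1]
    exact convex_ND (NC_subset_ND hb) hp' h0 (sub_nonneg.2 h1) (by ring)
  · rw [mixWiring_apply h0 h1 hq hs (NC_subset_ND hp').1]
    exact convex_NC hb hp' h0 (sub_nonneg.2 h1) (by ring)

theorem converts_refl {U : Scenario} {p b : U.Table} (hp : p ∈ U.ND) (hb : b ∈ U.NC) :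
    Converts p p := by
  simpa using converts_mix hp hb le_rfl zero_le_one

/-! ### Coordinates on the tables of the cycle scenario -/

section Cycle

theorem intUnits_cast_eq_one_or (u : ℤˣ) : ((u : ℤ) : ℝ) = 1 ∨ ((u : ℤ) : ℝ) = -1 := by
  rcases Int.units_eq_one_or u with rfl | rfl <;> simp

/-- A sum over all assignments cancels if changing one coordinate changes the sign of one factor and
keeps the other. -/
theorem sum_mul_eq_zero_of_flip {ι : Type} [Fintype ι] [DecidableEq ι] {O : ι → Type}
    [∀ i, Fintype (O i)] (i : ι) {σ : O i → ℝ} {τ : O i → O i} (hτ : ∀ o, τ (τ o) = o)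
    (hσ : ∀ o, σ (τ o) = -σ o) (F : ((i : ι) → O i) → ℝ)
    (hF : ∀ l o, F (Function.update l i o) = F l) : ∑ l, σ (l i) * F l = 0 := by
  refine Finset.sum_involution (fun l _ => Function.update l i (τ (l i))) ?_ ?_ ?_ ?_
  · intro l _
    rw [hF, Function.update_self, hσ]
    ring
  · intro l _ h h'
    have h2 := congrFun h' i
    rw [Function.update_self] at h2
    have h3 := hσ (l i)
    rw [h2] at h3
    exact left_ne_zero_of_mul h (by linarith)
  · intro l _
    exact Finset.mem_univ _
  · intro l _
    simp [hτ]

variable {n : ℕ} [NeZero n]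

/-- The outcomes `0` and `1` of a measurement of the `n`-cycle scenario as the numbers `1` and
`-1`. -/
def sig {x : (cycle n).M} (o : (cycle n).O x) : ℝ :=
  (fun y : Fin 2 => if y = 0 then 1 else -1) o

/-- The other outcome. -/
def flipOut {x : (cycle n).M} (o : (cycle n).O x) : (cycle n).O x := (fun y : Fin 2 => 1 - y) o

theorem sig_eq_one_or {x : (cycle n).M} (o : (cycle n).O x) : sig o = 1 ∨ sig o = -1 := by
  have : ∀ y : Fin 2, (if y = 0 then (1 : ℝ) else -1) = 1 ∨
      (if y = 0 then (1 : ℝ) else -1) = -1 := fun y => ite_eq_or_eq _ _ _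
  exact this o

theorem abs_sig {x : (cycle n).M} (o : (cycle n).O x) : |sig o| = 1 := by
  rcases sig_eq_one_or o with h | h <;> simp [h]

theorem flipOut_flipOut {x : (cycle n).M} (o : (cycle n).O x) : flipOut (flipOut o) = o :=
  sub_sub_cancel (1 : Fin 2) o

theorem sig_flipOut {x : (cycle n).M} (o : (cycle n).O x) : sig (flipOut o) = -sig o := by
  have : ∀ y : Fin 2, (if 1 - y = 0 then (1 : ℝ) else -1) = -(if y = 0 then 1 else -1) := by
    intro y
    fin_cases y <;> simp
  exact this o

theorem one_add_sig_mul_sig {x : (cycle n).M} (o o' : (cycle n).O x) :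
    1 + sig o * sig o' = 2 ∧ o = o' ∨ 1 + sig o * sig o' = 0 := by
  have : ∀ y z : Fin 2, 1 + (if y = 0 then (1 : ℝ) else -1) * (if z = 0 then (1 : ℝ) else -1) = 2 ∧
      y = z ∨ 1 + (if y = 0 then (1 : ℝ) else -1) * (if z = 0 then (1 : ℝ) else -1) = 0 := by
    intro y z
    fin_cases y <;> fin_cases z <;> norm_num
  exact this o o'

theorem one_add_sig_mul_self {x : (cycle n).M} (o : (cycle n).O x) : 1 + sig o * sig o = 2 := by
  rcases sig_eq_one_or o with h | h <;> rw [h] <;> norm_num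

/-- The first measurement of the context `{x_i, x_{i+1}}`. -/
abbrev edgeFst (i : Fin n) : {x // x ∈ (edge i).1} := ⟨meas i, Finset.mem_insert_self _ _⟩

/-- The second measurement of the context `{x_i, x_{i+1}}`. -/
abbrev edgeSnd (i : Fin n) : {x // x ∈ (edge i).1} :=
  ⟨meas (i + 1), Finset.mem_insert_of_mem (Finset.mem_singleton_self _)⟩

theorem exists_eq_edge (γ : (cycle n).Ctx) : ∃ i : Fin n, γ = edge i := by
  obtain ⟨γ, hγ⟩ := γ
  obtain ⟨i, -, rfl⟩ := Finset.mem_image.1 hγ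
  exact ⟨i, rfl⟩

theorem eq_edgeFst_or_eq_edgeSnd (i : Fin n) (x : {x // x ∈ (edge i).1}) :
    x = edgeFst i ∨ x = edgeSnd i := by
  obtain ⟨x, hx⟩ := x
  rcases Finset.mem_insert.1 hx with rfl | h
  · exact Or.inl rfl
  · right
    rw [Finset.mem_singleton] at h
    subst h
    rfl

theorem paritySign_eq (i : Fin n) (s : (cycle n).Out (edge i).1) :
    paritySign i s = sig (s (edgeFst i)) * sig (s (edgeSnd i)) := by
  have : ∀ (x y : Fin 2) [Decidable (x = y)], (if x = y then (1 : ℝ) else -1) =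
      (if x = 0 then 1 else -1) * (if y = 0 then 1 else -1) := by
    intro x y _
    fin_cases x <;> fin_cases y <;> simp
  exact @this (s (edgeFst i)) (s (edgeSnd i)) (_)

/-- The expectation value `⟨x_i⟩` of the sign of `x_i`. -/
def bias (p : (cycle n).Table) (i : Fin n) : ℝ := mean p (edge i) (edgeFst i) sig

theorem mean_edgeSnd {p : (cycle n).Table} (hp : p ∈ (cycle n).ND) (i : Fin n) :
    mean p (edge i) (edgeSnd i) sig = bias p (i + 1) :=
  mean_eq_of_mem_ND hp _ _ _ _ _ _

theorem corr_add (p p' : (cycle n).Table) (i : Fin n) :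
    corr (p + p') i = corr p i + corr p' i := by
  simp [corr, mul_add, Finset.sum_add_distrib]

theorem corr_smul (c : ℝ) (p : (cycle n).Table) (i : Fin n) :
    corr (c • p) i = c * corr p i := by
  simp only [corr, Pi.smul_apply, smul_eq_mul, Finset.mul_sum]
  exact Finset.sum_congr rfl fun _ _ => by ring

theorem ineqFun_add (a : Fin n → ℤˣ) (p p' : (cycle n).Table) :
    ineqFun a (p + p') = ineqFun a p + ineqFun a p' := by
  simp [ineqFun, corr_add, mul_add, Finset.sum_add_distrib]

theorem ineqFun_smul (a : Fin n → ℤˣ) (c : ℝ) (p : (cycle n).Table) :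
    ineqFun a (c • p) = c * ineqFun a p := by
  simp only [ineqFun, corr_smul, Finset.mul_sum]
  exact Finset.sum_congr rfl fun _ _ => by ring

/-- The Fourier expansion of the distribution in the context `{x_i, x_{i+1}}`. -/
theorem four_mul_apply_edge (p : (cycle n).Table) (i : Fin n) (s : (cycle n).Out (edge i).1) :
    4 * p (edge i) s = ∑ s', p (edge i) s'
      + sig (s (edgeFst i)) * mean p (edge i) (edgeFst i) sig
      + sig (s (edgeSnd i)) * mean p (edge i) (edgeSnd i) sig
      + sig (s (edgeFst i)) * sig (s (edgeSnd i)) * corr p i := by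
  have hs : ∀ s' : (cycle n).Out (edge i).1, s' ≠ s →
      (1 + sig (s (edgeFst i)) * sig (s' (edgeFst i))) *
        (1 + sig (s (edgeSnd i)) * sig (s' (edgeSnd i))) = 0 := by
    intro s' hs'
    rcases one_add_sig_mul_sig (s (edgeFst i)) (s' (edgeFst i)) with ⟨-, h1⟩ | h
    · rcases one_add_sig_mul_sig (s (edgeSnd i)) (s' (edgeSnd i)) with ⟨-, h2⟩ | h
      · refine absurd (funext fun x => ?_) hs'
        rcases eq_edgeFst_or_eq_edgeSnd i x with rfl | rfl
        exacts [h1.symm, h2.symm]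
      · rw [h, mul_zero]
    · rw [h, zero_mul]
  calc 4 * p (edge i) s
      = ∑ s', (1 + sig (s (edgeFst i)) * sig (s' (edgeFst i))) *
        (1 + sig (s (edgeSnd i)) * sig (s' (edgeSnd i))) * p (edge i) s' := by
        rw [Finset.sum_eq_single s]
        · rw [one_add_sig_mul_self, one_add_sig_mul_self]
          norm_num
        · intro s' _ h
          rw [hs s' h, zero_mul]
        · simp
    _ = _ := by
        simp only [mean, corr, Finset.mul_sum, ← Finset.sum_add_distrib, paritySign_eq]
        exact Finset.sum_congr rfl fun _ _ => by ring

/-- A table is determined by the normalizations, the expectation values and the correlations. -/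
theorem table_ext {p p' : (cycle n).Table}
    (h0 : ∀ i : Fin n, ∑ s, p (edge i) s = ∑ s, p' (edge i) s)
    (h1 : ∀ i : Fin n, mean p (edge i) (edgeFst i) sig = mean p' (edge i) (edgeFst i) sig)
    (h2 : ∀ i : Fin n, mean p (edge i) (edgeSnd i) sig = mean p' (edge i) (edgeSnd i) sig)
    (h3 : ∀ i : Fin n, corr p i = corr p' i) : p = p' := by
  funext γ s
  obtain ⟨i, rfl⟩ := exists_eq_edge γ
  have e := four_mul_apply_edge p i s
  rw [h0, h1, h2, h3, ← four_mul_apply_edge] at e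
  linarith

theorem ND_ext {p p' : (cycle n).Table} (hp : p ∈ (cycle n).ND) (hp' : p' ∈ (cycle n).ND)
    (hb : ∀ i, bias p i = bias p' i) (hc : ∀ i, corr p i = corr p' i) : p = p' := by
  refine table_ext (fun i => ?_) hb (fun i => ?_) hc
  · rw [(hp.1 _).2, (hp'.1 _).2]
  · rw [mean_edgeSnd hp, mean_edgeSnd hp', hb]

/-! ### Sign patterns around the cycle -/

/-- As an odd number of the signs `a_k` are `-1`, there are signs `D_k` for the measurements with
`D_k D_{k+1} = a_k` except at one given place `j`. -/
theorem exists_signs {a : Fin n → ℤˣ} (ha : OddSigns a) (j : Fin n) :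
    ∃ D : Fin n → ℤˣ, ∀ k, D k * D (k + 1) = if k = j then -a k else a k := by
  have hn : 0 < n := Nat.pos_of_ne_zero (NeZero.ne n)
  have hprod : ∏ k, a k = -1 := by
    have h : ∀ k, a k = if a k = -1 then -1 else 1 := by
      intro k
      rcases Int.units_eq_one_or (a k) with h | h <;> rw [h] <;> decide
    rw [Finset.prod_congr rfl fun k _ => h k, Finset.prod_ite, Finset.prod_const,
      Finset.prod_const_one, mul_one]
    exact Odd.neg_one_pow ha
  set A : ℕ → ℤˣ := fun m => a (Fin.ofNat n m) with hA
  have hAk : ∀ k : Fin n, A k.val = a k := fun k => by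
    simp [hA]
  set e : ℕ → ℤˣ := fun m => ∏ i ∈ Finset.range m, A i with he
  have hen : e n = -1 := by
    rw [he, ← hprod]
    simp only
    rw [Finset.prod_range]
    exact Finset.prod_congr rfl fun k _ => hAk k
  have hsucc : ∀ m, e (m + 1) = e m * A m := fun m => Finset.prod_range_succ _ _
  have hsq : ∀ u : ℤˣ, u * u = 1 := Int.units_mul_self
  refine ⟨fun k => e k.val * if k.val ≤ j.val then 1 else -1, fun k => ?_⟩
  have hval : (k + 1).val = if k.val + 1 = n then 0 else k.val + 1 := by
    have := k.isLt
    rw [Fin.val_add]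
    rcases Nat.lt_or_ge 1 n with h | h
    · rw [Fin.val_one', Nat.mod_eq_of_lt h]
      split_ifs with h'
      · rw [h', Nat.mod_self]
      · exact Nat.mod_eq_of_lt (by omega)
    · obtain rfl : n = 1 := by omega
      simp
  have hkj : k = j ↔ k.val = j.val := Fin.ext_iff
  have := k.isLt
  have := j.isLt
  by_cases hlast : k.val + 1 = n
  · -- the chain closes up with the product of all `a_k`, which is `-1`
    have h0 : e k.val = -a k := by
      have := hsucc k.val
      rw [hlast, hen, hAk] at this
      rw [← mul_one (e k.val), ← hsq (a k), ← mul_assoc, ← this, neg_one_mul]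
    have h00 : e 0 = 1 := by simp [he]
    simp only [hval, if_pos hlast, h0, h00, hkj]
    by_cases h : k.val = j.val
    · simp [h]
    · rw [if_neg (by omega), if_neg h]
      simp
  · have h0 : e k.val * e (k.val + 1) = a k := by
      rw [hsucc, ← mul_assoc, hsq, one_mul, hAk]
    simp only [hval, if_neg hlast, hkj]
    rw [mul_mul_mul_comm, h0]
    split_ifs <;> first | omega | simp

theorem bias_add (p p' : (cycle n).Table) (i : Fin n) :
    bias (p + p') i = bias p i + bias p' i := mean_add _ _ _ _ _

theorem bias_smul (c : ℝ) (p : (cycle n).Table) (i : Fin n) : bias (c • p) i = c * bias p i :=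
  mean_smul _ _ _ _ _

/-- The facet inequality `d ⟨x_i⟩ - d' ⟨x_{i+1}⟩ ≤ 1 - d d' ⟨x_i x_{i+1}⟩` of the no-disturbance
polytope. -/
theorem bias_sub_bias_le {p : (cycle n).Table} (hp : p ∈ (cycle n).ND) (i : Fin n) (d d' : ℤˣ) :
    ((d : ℤ) : ℝ) * bias p i - ((d' : ℤ) : ℝ) * bias p (i + 1) ≤
      1 - ((d * d' : ℤˣ) : ℤ) * corr p i := by
  rw [← mean_edgeSnd hp, ← (hp.1 (edge i)).2]
  simp only [bias, mean, corr, Finset.mul_sum, ← Finset.sum_sub_distrib]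
  refine Finset.sum_le_sum fun s _ => ?_
  rw [paritySign_eq]
  have h0 := (hp.1 (edge i)).1 s
  push_cast
  rcases intUnits_cast_eq_one_or d with hd | hd <;>
  rcases intUnits_cast_eq_one_or d' with hd' | hd' <;>
  rcases sig_eq_one_or (s (edgeFst i)) with h1 | h1 <;>
  rcases sig_eq_one_or (s (edgeSnd i)) with h2 | h2 <;>
  rw [hd, hd', h1, h2] <;> linarith

theorem ineqFun_le_sub_signed_bias {a D : Fin n → ℤˣ} {j : Fin n}
    (hD : ∀ k, D k * D (k + 1) = if k = j then -a k else a k)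
    {p : (cycle n).Table} (hp : p ∈ (cycle n).ND) :
    ineqFun a p ≤ n - 2 * (((D (j + 1) : ℤ) : ℝ) * bias p (j + 1)) := by
  have h : ∀ k, ((D k : ℤ) : ℝ) * bias p k - ((D (k + 1) : ℤ) : ℝ) * bias p (k + 1)
      + (if k = j then 2 * (((D (j + 1) : ℤ) : ℝ) * bias p (j + 1)) else 0) ≤
        1 - ((a k : ℤ) : ℝ) * corr p k := by
    intro k
    by_cases hk : k = j
    · have := bias_sub_bias_le hp k (D k) (-D (k + 1))
      rw [mul_neg, hD, if_pos hk, neg_neg] at this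
      push_cast at this
      rw [if_pos hk]
      subst hk
      linarith
    · have := bias_sub_bias_le hp k (D k) (D (k + 1))
      rw [hD, if_neg hk] at this
      rw [if_neg hk]
      linarith
  have hs := Finset.sum_le_sum fun k (_ : k ∈ Finset.univ) => h k
  simp only [Finset.sum_add_distrib, Finset.sum_sub_distrib, Finset.sum_ite_eq', Finset.mem_univ,
    if_true, Finset.sum_const, Finset.card_univ, Fintype.card_fin, nsmul_eq_mul, mul_one] at hs
  have hshift := Equiv.sum_comp (Equiv.addRight (1 : Fin n))
    (fun k => ((D k : ℤ) : ℝ) * bias p k)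
  simp only [Equiv.coe_addRight] at hshift
  rw [hshift] at hs
  simp only [ineqFun]
  linarith

/-- On the no-disturbance polytope a large value of `I` forces small expectation values: adding up
the facet inequalities around the cycle with signs that fit the `a_k` at all but one place `j`, all
expectation values cancel except that of `x_{j+1}`, which appears twice. -/
theorem ineqFun_le_sub_abs_bias {a : Fin n → ℤˣ} (ha : OddSigns a) {p : (cycle n).Table}
    (hp : p ∈ (cycle n).ND) (i : Fin n) : ineqFun a p ≤ n - 2 * |bias p i| := by
  obtain ⟨D, hD⟩ := exists_signs ha (i - 1)
  have h1 := ineqFun_le_sub_signed_bias hD hp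
  have h2 := ineqFun_le_sub_signed_bias (D := fun k => -D k) (by simpa using hD) hp
  rw [sub_add_cancel] at h1 h2
  push_cast at h2
  rcases intUnits_cast_eq_one_or (D i) with h | h <;> rw [h] at h1 h2 <;>
    rcases abs_cases (bias p i) with ⟨h', _⟩ | ⟨h', _⟩ <;> rw [h'] <;> linarith

theorem ineqFun_le_of_mem_ND {a : Fin n → ℤˣ} (ha : OddSigns a) {p : (cycle n).Table}
    (hp : p ∈ (cycle n).ND) : ineqFun a p ≤ n := by
  have := ineqFun_le_sub_abs_bias ha hp 0
  have := abs_nonneg (bias p 0)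
  linarith

theorem bias_detBox (l : (cycle n).Global) (i : Fin n) :
    bias (detBox l) i = sig (l (meas i)) :=
  sum_mul_detBox l (edge i) (fun s => sig (s (edgeFst i)))

theorem corr_detBox (l : (cycle n).Global) (i : Fin n) :
    corr (detBox l) i = sig (l (meas i)) * sig (l (meas (i + 1))) := by
  rw [corr, sum_mul_detBox, paritySign_eq]

/-- The deterministic behavior in which the measurements have the outcomes with the given
signs. -/
def signBox (D : Fin n → ℤˣ) : (cycle n).Table :=
  detBox fun k => (if D k = 1 then 0 else 1 : Fin 2)

theorem signBox_mem_NC (D : Fin n → ℤˣ) : signBox D ∈ (cycle n).NC := detBox_mem_NC _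

theorem sig_ite_eq (x : (cycle n).M) (u : ℤˣ) :
    sig (x := x) (if u = 1 then 0 else 1 : Fin 2) = ((u : ℤ) : ℝ) := by
  rcases Int.units_eq_one_or u with rfl | rfl <;> simp [sig]

theorem bias_signBox (D : Fin n → ℤˣ) (i : Fin n) : bias (signBox D) i = ((D i : ℤ) : ℝ) :=
  (bias_detBox _ i).trans (sig_ite_eq _ _)

theorem corr_signBox (D : Fin n → ℤˣ) (i : Fin n) :
    corr (signBox D) i = ((D i * D (i + 1) : ℤˣ) : ℤ) := by
  refine (corr_detBox _ i).trans ?_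
  push_cast
  exact congrArg₂ _ (sig_ite_eq _ _) (sig_ite_eq _ _)

theorem ineqFun_le_of_mem_NC {a : Fin n → ℤˣ} (ha : OddSigns a) {p : (cycle n).Table}
    (hp : p ∈ (cycle n).NC) : ineqFun a p ≤ n - 2 := by
  rw [NC_eq_convexHull] at hp
  refine convexHull_min (t := {p | ineqFun a p ≤ n - 2}) ?_ ?_ hp
  · rintro _ ⟨l, rfl⟩
    have := ineqFun_le_sub_abs_bias ha (NC_subset_ND (detBox_mem_NC l)) 0
    rw [bias_detBox, abs_sig] at this
    simpa using this
  · intro p hp p' hp' s t hs ht hst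
    simp only [Set.mem_ofPred_eq, ineqFun_add, ineqFun_smul] at hp hp' ⊢
    nlinarith

/-! ### The contextual vertex -/

theorem bias_eq_zero_of_ineqFun_eq {a : Fin n → ℤˣ} (ha : OddSigns a) {p : (cycle n).Table}
    (hp : p ∈ (cycle n).ND) (h : ineqFun a p = n) (i : Fin n) : bias p i = 0 := by
  have := ineqFun_le_sub_abs_bias ha hp i
  have := abs_nonneg (bias p i)
  exact abs_eq_zero.1 (by linarith)

theorem corr_eq_of_ineqFun_eq {a : Fin n → ℤˣ} {p : (cycle n).Table}
    (hp : p ∈ (cycle n).ND) (h : ineqFun a p = n) (i : Fin n) : corr p i = (a i : ℤ) := by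
  have hle : ∀ k, ((a k : ℤ) : ℝ) * corr p k ≤ 1 := by
    intro k
    have h1 := bias_sub_bias_le hp k (a k) 1
    have h2 := bias_sub_bias_le hp k (-a k) (-1)
    simp only [mul_one, mul_neg, neg_neg] at h1 h2
    push_cast at h1 h2
    linarith
  have hsum : ∑ k, (1 - ((a k : ℤ) : ℝ) * corr p k) = 0 := by
    rw [Finset.sum_sub_distrib]
    simp only [ineqFun] at h
    simp [h]
  have := (Finset.sum_eq_zero_iff_of_nonneg fun k _ => sub_nonneg.2 (hle k)).1 hsum i
    (Finset.mem_univ i)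
  rcases intUnits_cast_eq_one_or (a i) with h | h <;> rw [h] at this ⊢ <;> linarith

theorem eq_of_ineqFun_eq {a : Fin n → ℤˣ} (ha : OddSigns a) {p p' : (cycle n).Table}
    (hp : p ∈ (cycle n).ND) (hp' : p' ∈ (cycle n).ND) (h : ineqFun a p = n)
    (h' : ineqFun a p' = n) : p = p' :=
  ND_ext hp hp'
    (fun i => by rw [bias_eq_zero_of_ineqFun_eq ha hp h, bias_eq_zero_of_ineqFun_eq ha hp' h'])
    (fun i => by rw [corr_eq_of_ineqFun_eq hp h, corr_eq_of_ineqFun_eq hp' h'])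

theorem mem_NDC_of_ineqFun_eq {a : Fin n → ℤˣ} (ha : OddSigns a) {v : (cycle n).Table}
    (hv : v ∈ (cycle n).ND) (h : ineqFun a v = n) : v ∈ NDC n := by
  refine ⟨⟨hv, fun p hp p' hp' hpp' => ?_⟩, fun hNC => ?_⟩
  · obtain ⟨s, t, hs, ht, hst, e⟩ := hpp'
    have h1 := ineqFun_le_of_mem_ND ha hp
    have h2 := ineqFun_le_of_mem_ND ha hp'
    rw [← e, ineqFun_add, ineqFun_smul, ineqFun_smul] at h
    have h3 : ineqFun a p = n := by nlinarith
    exact eq_of_ineqFun_eq ha hp hv h3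
      (by rw [← e, ineqFun_add, ineqFun_smul, ineqFun_smul, h])
  · have := ineqFun_le_of_mem_NC ha hNC.1
    linarith

theorem ne_add_one (hn : 3 ≤ n) (i : Fin n) : i + 1 ≠ i := by
  intro h
  have h1 : (1 : Fin n) = 0 := by simpa using h
  have h2 := congrArg Fin.val h1
  rw [Fin.val_one', Fin.val_zero, Nat.mod_eq_of_lt (by omega)] at h2
  omega

theorem isBehavior_uniformBox : IsBehavior (uniformBox n) := by
  intro γ
  refine ⟨fun s => by unfold uniformBox; positivity, ?_⟩
  have : (Fintype.card ((cycle n).Out γ.1) : ℝ) ≠ 0 :=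
    Nat.cast_ne_zero.2 Fintype.card_ne_zero
  simp only [uniformBox, Finset.sum_const, nsmul_eq_mul, Finset.card_univ]
  exact mul_one_div_cancel this

theorem mean_uniformBox (γ : (cycle n).Ctx) (x : {x // x ∈ γ.1}) :
    mean (uniformBox n) γ x sig = 0 :=
  sum_mul_eq_zero_of_flip x flipOut_flipOut sig_flipOut
    (fun _ => 1 / (Fintype.card ((cycle n).Out γ.1) : ℝ)) fun _ _ => rfl

theorem corr_uniformBox (hn : 3 ≤ n) (i : Fin n) : corr (uniformBox n) i = 0 := by
  have hne : edgeSnd i ≠ edgeFst i := fun h => ne_add_one hn i (congrArg Subtype.val h)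
  have := sum_mul_eq_zero_of_flip (edgeFst i) flipOut_flipOut sig_flipOut
    (fun s : (cycle n).Out (edge i).1 => sig (s (edgeSnd i)) *
    (1 / (Fintype.card ((cycle n).Out (edge i).1) : ℝ))) fun l o => by
      exact congrArg (fun o' => sig o' * _) (Function.update_of_ne hne o l)
  rw [corr, ← this]
  refine Finset.sum_congr rfl fun s _ => ?_
  rw [paritySign_eq, mul_assoc]
  rfl

/-- The uniform distribution on the global assignments is a global section of `B_∅`. -/
theorem uniformBox_mem_NC (hn : 3 ≤ n) : uniformBox n ∈ (cycle n).NC := by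
  set c : ℝ := (Fintype.card (Fin n → Fin 2) : ℝ)⁻¹ with hc
  have hc0 : 0 ≤ c := by positivity
  have hc1 : ∑ _l : (cycle n).Global, c = 1 := by
    have : (Fintype.card (Fin n → Fin 2) : ℝ) ≠ 0 := Nat.cast_ne_zero.2 Fintype.card_ne_zero
    rw [Finset.sum_const, nsmul_eq_mul]
    exact mul_inv_cancel₀ this
  refine mem_NC_iff.2 ⟨fun _ => c, fun _ => hc0, hc1, ?_⟩
  have hmean : ∀ i (x : {x // x ∈ (edge i).1}),
      mean (ofGlobal (U := cycle n) fun _ => c) (edge i) x sig = 0 := fun i x =>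
    (sum_mul_ofGlobal (U := cycle n) _ (edge i) fun s => sig (s x)).trans
      (sum_mul_eq_zero_of_flip x.1 flipOut_flipOut sig_flipOut (fun _ => c) fun _ _ => rfl)
  refine table_ext (fun i => ?_) (fun i => ?_) (fun i => ?_) (fun i => ?_)
  · rw [(isBehavior_uniformBox _).2, (isBehavior_ofGlobal (fun _ => hc0) hc1 _).2]
  · rw [mean_uniformBox, hmean]
  · rw [mean_uniformBox, hmean]
  · rw [corr_uniformBox hn, corr, sum_mul_ofGlobal]
    have := sum_mul_eq_zero_of_flip (meas i) flipOut_flipOut sig_flipOut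
      (fun l : (cycle n).Global => sig (l (meas (i + 1))) * c) fun l o => by
      exact congrArg (fun o' => sig o' * c)
        (Function.update_of_ne (a := meas (i + 1)) (ne_add_one hn i) o l)
    rw [← this]
    refine Finset.sum_congr rfl fun l _ => ?_
    rw [paritySign_eq, mul_assoc]

/-- The mixture of the `2n` deterministic behaviors with `I = n - 2`: a noncontextual behavior
with vanishing expectation values on the facet `I = n - 2`. -/
theorem exists_mem_NC_bias_corr {a : Fin n → ℤˣ} (ha : OddSigns a) :
    ∃ p ∈ (cycle n).NC, (∀ i, bias p i = 0) ∧
      ∀ i, corr p i = ((n : ℝ) - 2) / n * ((a i : ℤ) : ℝ) := by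
  have hn0 : (n : ℝ) ≠ 0 := Nat.cast_ne_zero.2 (NeZero.ne n)
  choose D hD using exists_signs ha
  set P : Fin n → (cycle n).Table := fun j =>
    (1 / 2 : ℝ) • signBox (D j) +
      (1 / 2 : ℝ) • signBox (fun k => -D j k) with hP
  have hPNC : ∀ j, P j ∈ (cycle n).NC := fun j =>
    convex_NC (signBox_mem_NC _) (signBox_mem_NC _) (by norm_num) (by norm_num) (by norm_num)
  have hPb : ∀ j i, bias (P j) i = 0 := by
    intro j i
    rw [hP, bias_add, bias_smul, bias_smul, bias_signBox, bias_signBox]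
    push_cast
    ring
  have hPc : ∀ j i, corr (P j) i = ((a i : ℤ) : ℝ) * (1 - if i = j then 2 else 0) := by
    intro j i
    rw [hP, corr_add, corr_smul, corr_smul, corr_signBox, corr_signBox, neg_mul_neg, hD]
    split_ifs <;> push_cast <;> ring
  refine ⟨∑ j, (1 / n : ℝ) • P j,
    convex_NC.sum_mem (fun _ _ => by positivity) (by simp [hn0]) fun j _ => hPNC j, ?_, ?_⟩
  · intro i
    have : bias (∑ j, (1 / n : ℝ) • P j) i = ∑ j, bias ((1 / n : ℝ) • P j) i :=
      map_sum (⟨⟨fun p => bias p i, by simp [bias, mean]⟩, fun p p' => bias_add p p' i⟩ :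
        (cycle n).Table →+ ℝ) _ _
    rw [this]
    exact Finset.sum_eq_zero fun j _ => by rw [bias_smul, hPb, mul_zero]
  · intro i
    have : corr (∑ j, (1 / n : ℝ) • P j) i = ∑ j, corr ((1 / n : ℝ) • P j) i :=
      map_sum (⟨⟨fun p => corr p i, by simp [corr]⟩, fun p p' => corr_add p p' i⟩ :
        (cycle n).Table →+ ℝ) _ _
    rw [this]
    simp only [corr_smul, hPc, ← Finset.mul_sum, Finset.sum_sub_distrib, Finset.sum_ite_eq,
      Finset.mem_univ, if_true, Finset.sum_const, Finset.card_univ, Fintype.card_fin,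
      nsmul_eq_mul, mul_one]
    ring

/-- `B_k' = ((n - 2)/n) B_k + (2/n) B_∅` is noncontextual. -/
theorem facetPoint_mem_NC (hn : 3 ≤ n) {a : Fin n → ℤˣ} (ha : OddSigns a) {v : (cycle n).Table}
    (hv : v ∈ (cycle n).ND) (h : ineqFun a v = n) :
    (((n : ℝ) - 2) / n) • v + (2 / (n : ℝ)) • uniformBox n ∈ (cycle n).NC := by
  have hn' : (3 : ℝ) ≤ n := by exact_mod_cast hn
  obtain ⟨p, hp, hb, hc⟩ := exists_mem_NC_bias_corr ha
  have hND : (((n : ℝ) - 2) / n) • v + (2 / (n : ℝ)) • uniformBox n ∈ (cycle n).ND :=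
    convex_ND hv (NC_subset_ND (uniformBox_mem_NC hn)) (div_nonneg (by linarith) (by linarith))
      (by positivity) (by field_simp; ring)
  convert hp
  refine ND_ext hND (NC_subset_ND hp) (fun i => ?_) (fun i => ?_)
  · rw [bias_add, bias_smul, bias_smul, bias_eq_zero_of_ineqFun_eq ha hv h, hb, bias,
      mean_uniformBox]
    ring
  · rw [corr_add, corr_smul, corr_smul, corr_eq_of_ineqFun_eq hv h, hc, corr_uniformBox hn]
    ring

/-- The behavior `B_k`. It has a global section with negative weights, as the solution `v` of
`B_k' = ((n - 2)/n) v + (2/n) B_∅` where `B_k'` is a mixture of deterministic behaviors. -/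
theorem exists_mem_ND_ineqFun_eq (hn : 3 ≤ n) {a : Fin n → ℤˣ} (ha : OddSigns a) :
    ∃ v ∈ (cycle n).ND, ineqFun a v = n := by
  have hn' : (3 : ℝ) ≤ n := by exact_mod_cast hn
  have hn2 : (n : ℝ) - 2 ≠ 0 := by linarith
  have hn0 : (n : ℝ) ≠ 0 := by linarith
  obtain ⟨p, hp, hb, hc⟩ := exists_mem_NC_bias_corr ha
  set v : (cycle n).Table := ((n : ℝ) / (n - 2)) • p + (-2 / ((n : ℝ) - 2)) • uniformBox n with hv
  have hpB := (NC_subset_ND hp).1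
  have hcv : ∀ i, corr v i = (a i : ℤ) := by
    intro i
    rw [hv, corr_add, corr_smul, corr_smul, hc, corr_uniformBox hn]
    field_simp
    ring
  have hsum : ∀ γ, ∑ s, v γ s = 1 := by
    intro γ
    simp only [hv, Pi.add_apply, Pi.smul_apply, smul_eq_mul, Finset.sum_add_distrib,
      ← Finset.mul_sum, (hpB γ).2, (isBehavior_uniformBox γ).2]
    field_simp
    ring
  have hbeh : IsBehavior v := by
    refine fun γ => ⟨fun s => ?_, hsum γ⟩
    obtain ⟨i, rfl⟩ := exists_eq_edge γ
    have h1 : mean v (edge i) (edgeFst i) sig = 0 := by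
      rw [hv, mean_add, mean_smul, mean_smul, mean_uniformBox]
      have := hb i
      rw [bias] at this
      rw [this]
      ring
    have h2 : mean v (edge i) (edgeSnd i) sig = 0 := by
      rw [hv, mean_add, mean_smul, mean_smul, mean_uniformBox, mean_edgeSnd (NC_subset_ND hp), hb]
      ring
    have := four_mul_apply_edge v i s
    rw [hsum, h1, h2, hcv] at this
    rcases intUnits_cast_eq_one_or (a i) with h | h <;>
    rcases sig_eq_one_or (s (edgeFst i)) with h1 | h1 <;>
    rcases sig_eq_one_or (s (edgeSnd i)) with h2 | h2 <;>
    rw [h, h1, h2] at this <;> linarith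
  refine ⟨v, ?_, ?_⟩
  · obtain ⟨q, -, -, hq⟩ := mem_NC_iff.1 hp
    obtain ⟨q', -, -, hq'⟩ := mem_NC_iff.1 (uniformBox_mem_NC hn)
    rw [hv, hq, hq', ← ofGlobal_smul, ← ofGlobal_smul, ← ofGlobal_add] at hbeh ⊢
    exact ofGlobal_mem_ND hbeh
  · have : ∀ u : ℤˣ, ((u : ℤ) : ℝ) * ((u : ℤ) : ℝ) = 1 := fun u => by
      rcases intUnits_cast_eq_one_or u with h | h <;> rw [h] <;> norm_num
    simp [ineqFun, hcv, this]

theorem exists_extremePoint_ineqFun_eq {a : Fin n → ℤˣ} (ha : OddSigns a) :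
    ∃ b ∈ (cycle n).NC.extremePoints ℝ, ineqFun a b = n - 2 := by
  obtain ⟨D, hD⟩ := exists_signs ha 0
  refine ⟨signBox D, detBox_mem_extremePoints _, ?_⟩
  have : ∀ i, ((a i : ℤ) : ℝ) * corr (signBox D) i = 1 - if i = 0 then 2 else 0 := by
    intro i
    rw [corr_signBox, hD]
    rcases intUnits_cast_eq_one_or (a i) with h | h <;> split_ifs <;> push_cast <;> rw [h] <;>
      norm_num
  simp only [ineqFun, this]
  simp [Finset.sum_sub_distrib]

end Cycle

/-! ### Statistics of single measurements -/

section Cycle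

variable {n : ℕ} [NeZero n]

/-- The probability that the sign of the outcome of `x_i` is `e`. -/
def signProb (p : (cycle n).Table) (i : Fin n) (e : ℝ) : ℝ :=
  mean p (edge i) (edgeFst i) fun o => (1 + e * sig o) / 2

theorem signProb_add (p p' : (cycle n).Table) (i : Fin n) (e : ℝ) :
    signProb (p + p') i e = signProb p i e + signProb p' i e := mean_add _ _ _ _ _

theorem signProb_smul (c : ℝ) (p : (cycle n).Table) (i : Fin n) (e : ℝ) :
    signProb (c • p) i e = c * signProb p i e := mean_smul _ _ _ _ _

theorem signProb_nonneg {p : (cycle n).Table} (hp : IsBehavior p) (i : Fin n) {e : ℝ}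
    (he : |e| = 1) : 0 ≤ signProb p i e := by
  refine mean_nonneg hp _ _ fun o => ?_
  rcases eq_or_eq_neg_of_abs_eq he with rfl | rfl <;>
    rcases sig_eq_one_or o with h | h <;> rw [h] <;> norm_num

theorem signProb_eq {p : (cycle n).Table} (hp : IsBehavior p) (i : Fin n) (e : ℝ) :
    signProb p i e = (1 + e * bias p i) / 2 := by
  have h := (hp (edge i)).2
  have : signProb p i e = (∑ s, p (edge i) s + e * bias p i) / 2 := by
    simp only [signProb, bias, mean, Finset.mul_sum, ← Finset.sum_add_distrib, Finset.sum_div]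
    exact Finset.sum_congr rfl fun _ _ => by ring
  rw [this, h]

theorem ineqFun_le_add_signProb {a : Fin n → ℤˣ} (ha : OddSigns a) {p : (cycle n).Table}
    (hp : p ∈ (cycle n).ND) (i : Fin n) {e : ℝ} (he : |e| = 1) :
    ineqFun a p ≤ n - 2 + 4 * signProb p i e := by
  have h := ineqFun_le_sub_abs_bias ha hp i
  rw [signProb_eq hp.1]
  have := neg_abs_le (e * bias p i)
  rw [abs_mul, he, one_mul] at this
  linarith

/-- In behaviors with vanishing expectation values both outcomes of every measurement are equally
likely, which fixes the statistics of single measurements. -/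
theorem exists_mean_eq_of_bias_eq_zero (γ : (cycle n).Ctx) (y : {y // y ∈ γ.1})
    (ψ : (cycle n).O y.1 → ℝ) :
    ∃ c : ℝ, ∀ p ∈ (cycle n).ND, (∀ i, bias p i = 0) → mean p γ y ψ = c := by
  have hψ : ∀ ψ : Fin 2 → ℝ, ∀ o : Fin 2,
      ψ o = (ψ 0 + ψ 1) / 2 + (ψ 0 - ψ 1) / 2 * if o = 0 then 1 else -1 := by
    intro ψ o
    fin_cases o <;> simp <;> ring
  obtain ⟨c, d, hcd⟩ : ∃ c d : ℝ, ∀ o, ψ o = c + d * sig o := ⟨_, _, hψ ψ⟩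
  refine ⟨c, fun p hp hb => ?_⟩
  have h0 : mean p γ y sig = 0 := by
    obtain ⟨i, rfl⟩ := exists_eq_edge γ
    rcases eq_edgeFst_or_eq_edgeSnd i y with rfl | rfl
    · exact hb i
    · rw [mean_edgeSnd hp, hb]
  have : mean p γ y ψ = c * ∑ s, p γ s + d * mean p γ y sig := by
    simp only [mean, Finset.mul_sum, ← Finset.sum_add_distrib, hcd]
    exact Finset.sum_congr rfl fun _ _ => by ring
  rw [this, h0, (hp.1 γ).2, mul_zero, add_zero, mul_one]

/-- A wiring maps behaviors with vanishing expectation values to behaviors with the same statistics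
of single measurements. -/
theorem mean_apply_eq_of_bias_eq_zero {V : Scenario} {p p' : (cycle n).Table}
    (hp : p ∈ (cycle n).ND) (hp' : p' ∈ (cycle n).ND) (h : ∀ i, bias p i = 0)
    (h' : ∀ i, bias p' i = 0) (w : Wiring (cycle n) V) (β : V.Ctx) (x : {x // x ∈ β.1})
    (φ : V.O x.1 → ℝ) : mean (w.apply p) β x φ = mean (w.apply p') β x φ := by
  obtain ⟨κ, hκ⟩ := w.exists_mean_apply_eq β x φ
  rw [hκ, hκ]
  refine Finset.sum_congr rfl fun r _ => ?_
  obtain ⟨c, hc⟩ := exists_mean_eq_of_bias_eq_zero _ _ (κ r)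
  rw [hc p hp h, hc p' hp' h']

/-! ### Cost and yield -/

/-- The noncontextual behavior `B_k' = ((n - 2)/n) B_k + (2/n) B_∅`, for `B_k = v`. -/
def facetPoint (v : (cycle n).Table) : (cycle n).Table :=
  (((n : ℝ) - 2) / n) • v + (2 / (n : ℝ)) • uniformBox n

theorem noisy_eq (v : (cycle n).Table) (ε : ℝ) :
    noisy v ε = ε • v + (1 - ε) • facetPoint v := rfl

theorem ineqFun_uniformBox (hn : 3 ≤ n) (a : Fin n → ℤˣ) : ineqFun a (uniformBox n) = 0 := by
  simp [ineqFun, corr_uniformBox hn]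

theorem ineqFun_noisy (hn : 3 ≤ n) {a : Fin n → ℤˣ} {v : (cycle n).Table}
    (h : ineqFun a v = n) (ε : ℝ) : ineqFun a (noisy v ε) = n - 2 + 2 * ε := by
  have hn0 : (n : ℝ) ≠ 0 := Nat.cast_ne_zero.2 (NeZero.ne n)
  simp only [noisy, ineqFun_add, ineqFun_smul, h, ineqFun_uniformBox hn]
  field_simp
  ring

theorem ineqFun_family (hn : 3 ≤ n) {a : Fin n → ℤˣ} {v b : (cycle n).Table}
    (h : ineqFun a v = n) (hb : ineqFun a b = n - 2) (α ε : ℝ) :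
    ineqFun a (family v b α ε) = n - 2 + 2 * ε * (1 - α) := by
  rw [family, ineqFun_add, ineqFun_smul, ineqFun_smul, ineqFun_noisy hn h, hb]
  ring

theorem bias_facetPoint {v : (cycle n).Table} (h : ∀ i, bias v i = 0) (i : Fin n) :
    bias (facetPoint v) i = 0 := by
  rw [facetPoint, bias_add, bias_smul, bias_smul, h, bias, mean_uniformBox]
  ring

theorem bias_noisy {v : (cycle n).Table} (h : ∀ i, bias v i = 0) (ε : ℝ) (i : Fin n) :
    bias (noisy v ε) i = 0 := by
  rw [noisy_eq, bias_add, bias_smul, bias_smul, h, bias_facetPoint h]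
  ring

theorem noisy_mem_ND {v : (cycle n).Table} (hv : v ∈ (cycle n).ND)
    (hF : facetPoint v ∈ (cycle n).NC) {ε : ℝ} (h0 : 0 ≤ ε) (h1 : ε ≤ 1) :
    noisy v ε ∈ (cycle n).ND :=
  convex_ND hv (NC_subset_ND hF) h0 (sub_nonneg.2 h1) (by ring)

theorem family_mem_ND {v b : (cycle n).Table} (hv : v ∈ (cycle n).ND)
    (hF : facetPoint v ∈ (cycle n).NC) (hb : b ∈ (cycle n).NC) {α ε : ℝ} (hα0 : 0 ≤ α)
    (hα1 : α ≤ 1) (h0 : 0 ≤ ε) (h1 : ε ≤ 1) : family v b α ε ∈ (cycle n).ND :=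
  convex_ND (NC_subset_ND hb) (noisy_mem_ND hv hF h0 h1) hα0 (sub_nonneg.2 hα1) (by ring)

theorem apply_family (w : Wiring (cycle n) (cycle n)) (v b : (cycle n).Table) (α ε : ℝ) :
    w.apply (family v b α ε) =
      α • w.apply b + (1 - α) • (ε • w.apply v + (1 - ε) • w.apply (facetPoint v)) := by
  simp only [family, noisy_eq, Wiring.apply_add, Wiring.apply_smul]

/-- No free wiring increases `I` on the family: only the weight `(1 - α) ε` of `B_k` can contribute
more than the noncontextual bound `n - 2`. -/
theorem ineqFun_apply_family_le {a : Fin n → ℤˣ} (ha : OddSigns a) {v b : (cycle n).Table}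
    (hv : v ∈ (cycle n).ND) (hF : facetPoint v ∈ (cycle n).NC) (hb : b ∈ (cycle n).NC) {α ε : ℝ}
    (hα0 : 0 ≤ α) (hα1 : α ≤ 1) (h0 : 0 ≤ ε) (h1 : ε ≤ 1) {w : Wiring (cycle n) (cycle n)}
    (hw : w.IsFree) : ineqFun a (w.apply (family v b α ε)) ≤ n - 2 + 2 * ε * (1 - α) := by
  have e1 := mul_le_mul_of_nonneg_left (ineqFun_le_of_mem_NC ha (hw.2 b hb)) hα0
  have e2 := mul_le_mul_of_nonneg_left (ineqFun_le_of_mem_ND ha (hw.1 v hv))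
    (mul_nonneg (sub_nonneg.2 hα1) h0)
  have e3 := mul_le_mul_of_nonneg_left (ineqFun_le_of_mem_NC ha (hw.2 _ hF))
    (mul_nonneg (sub_nonneg.2 hα1) (sub_nonneg.2 h1))
  rw [apply_family]
  simp only [ineqFun_add, ineqFun_smul]
  linarith

/-- After a free wiring of `B(α, ε)`, the violation of `I ≤ n - 2` is bounded by `4 ε` times the
probability of either outcome of `x_i`. Only `B_k` contributes to the violation, and its image
satisfies the bound with `4` in place of `4 ε`. The images of `B_k` and `B_k'` agree in the
probability for `x_i`, so that `B_k'` supplies the rest of this probability. -/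
theorem ineqFun_apply_family_le_signProb {a : Fin n → ℤˣ} (ha : OddSigns a)
    {v b : (cycle n).Table} (hv : v ∈ (cycle n).ND) (hI : ineqFun a v = n)
    (hF : facetPoint v ∈ (cycle n).NC) (hb : b ∈ (cycle n).NC) {α ε : ℝ}
    (hα0 : 0 ≤ α) (hα1 : α ≤ 1) (h0 : 0 ≤ ε) (h1 : ε ≤ 1) {w : Wiring (cycle n) (cycle n)}
    (hw : w.IsFree) (i : Fin n) {e : ℝ} (he : |e| = 1) :
    ineqFun a (w.apply (family v b α ε)) ≤
      n - 2 + 4 * ε * signProb (w.apply (family v b α ε)) i e := by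
  have hbias := bias_eq_zero_of_ineqFun_eq ha hv hI
  have e1 := mul_le_mul_of_nonneg_left (ineqFun_le_of_mem_NC ha (hw.2 b hb)) hα0
  have e2 := mul_le_mul_of_nonneg_left (ineqFun_le_add_signProb ha (hw.1 v hv) i he)
    (mul_nonneg (sub_nonneg.2 hα1) h0)
  have e3 := mul_le_mul_of_nonneg_left (ineqFun_le_of_mem_NC ha (hw.2 _ hF))
    (mul_nonneg (sub_nonneg.2 hα1) (sub_nonneg.2 h1))
  have e4 : signProb (w.apply (facetPoint v)) i e = signProb (w.apply v) i e :=
    mean_apply_eq_of_bias_eq_zero (NC_subset_ND hF) hv (bias_facetPoint hbias) hbias w _ _ _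
  have e5 := mul_nonneg (mul_nonneg h0 hα0) (signProb_nonneg (hw.1 b (NC_subset_ND hb)).1 i he)
  rw [apply_family]
  simp only [ineqFun_add, ineqFun_smul, signProb_add, signProb_smul, e4]
  linarith

/-- The parameter `ε` of the family does not increase under conversions: `4 ε` is
the ratio of the violation `2 ε (1 - α)` of `I ≤ n - 2` to the probability `(1 - α) / 2` of the
outcome of `x_0` that `b` excludes. -/
theorem le_of_converts_family (hn : 3 ≤ n) {a : Fin n → ℤˣ} (ha : OddSigns a)
    {v b b' : (cycle n).Table} (hv : v ∈ (cycle n).ND) (hI : ineqFun a v = n)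
    (hF : facetPoint v ∈ (cycle n).NC) (hb' : b' ∈ (cycle n).NC)
    (hb : b ∈ (cycle n).NC.extremePoints ℝ) (hbI : ineqFun a b = n - 2) {α ε α' ε' : ℝ}
    (hα0 : 0 ≤ α) (hα1 : α < 1) (h0 : 0 ≤ ε) (h1 : ε ≤ 1) (hα0' : 0 ≤ α') (hα1' : α' ≤ 1)
    (h0' : 0 ≤ ε') (h1' : ε' ≤ 1) (h : Converts (family v b' α' ε') (family v b α ε)) :
    ε ≤ ε' := by
  obtain ⟨w, hw, e⟩ := h
  obtain ⟨l, rfl⟩ := exists_eq_detBox_of_mem_extremePoints hb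
  have he : |-sig (l (meas 0))| = 1 := by rw [abs_neg, abs_sig]
  have key := ineqFun_apply_family_le_signProb ha hv hI hF hb' hα0' hα1' h0' h1' hw 0 he
  rw [e, ineqFun_family hn hI hbI, signProb_eq (family_mem_ND hv hF hb.1 hα0 hα1.le h0 h1).1,
    family, bias_add, bias_smul, bias_smul, bias_detBox,
    bias_noisy (bias_eq_zero_of_ineqFun_eq ha hv hI)] at key
  have hsq : sig (l (meas 0)) * sig (l (meas 0)) = 1 := by
    linarith [one_add_sig_mul_self (l (meas (0 : Fin n)))]
  have : 2 * ε * (1 - α) ≤ 2 * ε' * (1 - α) := by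
    linear_combination key - 2 * ε' * α * hsq
  exact le_of_mul_le_mul_right (by linarith) (sub_pos.2 hα1)

theorem family_zero (v b : (cycle n).Table) (ε : ℝ) : family v b 0 ε = noisy v ε := by
  simp [family]

theorem isLeast_costValues_family (hn : 3 ≤ n) {a : Fin n → ℤˣ} (ha : OddSigns a)
    {v b : (cycle n).Table} (hv : v ∈ (cycle n).ND) (hI : ineqFun a v = n)
    (hb : b ∈ (cycle n).NC.extremePoints ℝ) (hbI : ineqFun a b = n - 2) {α ε : ℝ}
    (hα0 : 0 ≤ α) (hα1 : α < 1) (h0 : 0 ≤ ε) (h1 : ε ≤ 1) :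
    IsLeast (costValues a v (family v b α ε)) (n - 2 + 2 * ε) := by
  have hF := facetPoint_mem_NC hn ha hv hI
  refine ⟨⟨ε, ⟨h0, h1⟩, converts_mix (noisy_mem_ND hv hF h0 h1) hb.1 hα0 hα1.le,
    ineqFun_noisy hn hI ε⟩, ?_⟩
  rintro _ ⟨ε', hε', hc, rfl⟩
  rw [← family_zero v b] at hc
  have := le_of_converts_family hn ha hv hI hF hb.1 hb hbI hα0 hα1 h0 h1 le_rfl zero_le_one
    hε'.1 hε'.2 hc
  rw [ineqFun_noisy hn hI]
  linarith

theorem isGreatest_yieldValues_family (hn : 3 ≤ n) {a : Fin n → ℤˣ} (ha : OddSigns a)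
    {v b : (cycle n).Table} (hv : v ∈ (cycle n).ND) (hI : ineqFun a v = n)
    (hb : b ∈ (cycle n).NC) (hbI : ineqFun a b = n - 2) {α ε : ℝ}
    (hα0 : 0 ≤ α) (hα1 : α ≤ 1) (h0 : 0 ≤ ε) (h1 : ε ≤ 1) :
    IsGreatest (yieldValues a (family v b α ε)) (n - 2 + 2 * ε * (1 - α)) := by
  have hF := facetPoint_mem_NC hn ha hv hI
  have hmem := family_mem_ND hv hF hb hα0 hα1 h0 h1
  refine ⟨⟨_, hmem, converts_refl hmem hb, ineqFun_family hn hI hbI α ε⟩, ?_⟩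
  rintro _ ⟨_, -, ⟨w, hw, rfl⟩, rfl⟩
  exact ineqFun_apply_family_le ha hv hF hb hα0 hα1 h0 h1 hw

/-- The weaker violation of `B(3/4, 1/2)` excludes one conversion, the smaller `ε` of `B(1/4, 1/4)`
the other. -/
theorem incomparable_family (hn : 3 ≤ n) {a : Fin n → ℤˣ} (ha : OddSigns a)
    {v b : (cycle n).Table} (hv : v ∈ (cycle n).ND) (hI : ineqFun a v = n)
    (hb : b ∈ (cycle n).NC.extremePoints ℝ) (hbI : ineqFun a b = n - 2) :
    Incomparable (family v b (1 / 4) (1 / 4)) (family v b (3 / 4) (1 / 2)) := by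
  have hF := facetPoint_mem_NC hn ha hv hI
  refine ⟨fun h => ?_, ?_⟩
  · have := le_of_converts_family hn ha hv hI hF hb.1 hb hbI (by norm_num) (by norm_num)
      (by norm_num) (by norm_num) (by norm_num) (by norm_num) (by norm_num) (by norm_num) h
    norm_num at this
  · rintro ⟨w, hw, e⟩
    have := ineqFun_apply_family_le ha hv hF hb.1 (α := 3 / 4) (ε := 1 / 2) (by norm_num)
      (by norm_num) (by norm_num) (by norm_num) hw
    rw [e, ineqFun_family hn hI hbI] at this
    linarith

end Cycle

end NCW

end

theorem mainTheorem5 :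
    (¬ ∀ X Y : NCW.Object, NCW.Converts X.2.1 Y.2.1 ∨ NCW.Converts Y.2.1 X.2.1) ∧
    ∀ (n : ℕ) [NeZero n], 3 ≤ n → ∀ a : Fin n → ℤˣ, NCW.OddSigns a →
      (∃! v, v ∈ NCW.NDC n ∧ NCW.ineqFun a v = n) ∧
      (∃ b ∈ (NCW.cycle n).NC.extremePoints ℝ, NCW.ineqFun a b = n - 2) ∧
      ∀ v ∈ NCW.NDC n, NCW.ineqFun a v = n →
      ∀ b ∈ (NCW.cycle n).NC.extremePoints ℝ, NCW.ineqFun a b = n - 2 →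
        NCW.family v b (1 / 4) (1 / 4) ∈ (NCW.cycle n).ND ∧
        NCW.family v b (3 / 4) (1 / 2) ∈ (NCW.cycle n).ND ∧
        NCW.Incomparable (NCW.family v b (1 / 4) (1 / 4)) (NCW.family v b (3 / 4) (1 / 2)) ∧
        IsLeast (NCW.costValues a v (NCW.family v b (1 / 4) (1 / 4))) (n - 3 / 2) ∧
        IsLeast (NCW.costValues a v (NCW.family v b (3 / 4) (1 / 2))) (n - 1) ∧
        IsGreatest (NCW.yieldValues a (NCW.family v b (1 / 4) (1 / 4))) (n - 13 / 8) ∧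
        IsGreatest (NCW.yieldValues a (NCW.family v b (3 / 4) (1 / 2))) (n - 7 / 4) := by
  refine ⟨fun h => ?_, ?_⟩
  · have ha : NCW.OddSigns (fun _ : Fin 3 => (-1 : ℤˣ)) := by
      unfold NCW.OddSigns
      decide
    obtain ⟨v, hv, hI⟩ := NCW.exists_mem_ND_ineqFun_eq le_rfl ha
    obtain ⟨b, hb, hbI⟩ := NCW.exists_extremePoint_ineqFun_eq ha
    have hF := NCW.facetPoint_mem_NC le_rfl ha hv hI
    have hinc := NCW.incomparable_family le_rfl ha hv hI hb hbI
    have h1 := NCW.family_mem_ND hv hF hb.1 (α := 1 / 4) (ε := 1 / 4) (by norm_num) (by norm_num)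
      (by norm_num) (by norm_num)
    have h2 := NCW.family_mem_ND hv hF hb.1 (α := 3 / 4) (ε := 1 / 2) (by norm_num) (by norm_num)
      (by norm_num) (by norm_num)
    exact (h ⟨_, _, h1⟩ ⟨_, _, h2⟩).elim hinc.1 hinc.2
  · intro n _ hn a ha
    refine ⟨?_, NCW.exists_extremePoint_ineqFun_eq ha, ?_⟩
    · obtain ⟨v, hv, hI⟩ := NCW.exists_mem_ND_ineqFun_eq hn ha
      exact ⟨v, ⟨NCW.mem_NDC_of_ineqFun_eq ha hv hI, hI⟩,
        fun v' hv' => NCW.eq_of_ineqFun_eq ha hv'.1.1.1 hv hv'.2 hI⟩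
    · intro v hv hI b hb hbI
      have hF := NCW.facetPoint_mem_NC hn ha hv.1.1 hI
      refine ⟨NCW.family_mem_ND hv.1.1 hF hb.1 ?_ ?_ ?_ ?_,
        NCW.family_mem_ND hv.1.1 hF hb.1 ?_ ?_ ?_ ?_,
        NCW.incomparable_family hn ha hv.1.1 hI hb hbI, ?_, ?_, ?_, ?_⟩
      iterate 8 norm_num
      · convert NCW.isLeast_costValues_family hn ha hv.1.1 hI hb hbI (α := 1 / 4) (ε := 1 / 4)
          (by norm_num) (by norm_num) (by norm_num) (by norm_num) using 1
        ring
      · convert NCW.isLeast_costValues_family hn ha hv.1.1 hI hb hbI (α := 3 / 4) (ε := 1 / 2)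
          (by norm_num) (by norm_num) (by norm_num) (by norm_num) using 1
        ring
      · convert NCW.isGreatest_yieldValues_family hn ha hv.1.1 hI hb.1 hbI (α := 1 / 4)
          (ε := 1 / 4) (by norm_num) (by norm_num) (by norm_num) (by norm_num) using 1
        ring
      · convert NCW.isGreatest_yieldValues_family hn ha hv.1.1 hI hb.1 hbI (α := 3 / 4)
          (ε := 1 / 2) (by norm_num) (by norm_num) (by norm_num) (by norm_num) using 1
        ring
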